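/- **Conventions.** Let $\mathcal A$ be a monoidal category with structure isomorphisms $\alpha,\lambda,\rho$, and write $X\otimes^{op}Y=Y\otimes X$. An *anti-involution* of $\mathcal A$ is a monoidal functor $(\Phi,\Phi_2,\Phi_0)\colon(\mathcal A,\otimes)\to(\mathcal A,\otimes^{op})$, with $(\Phi_2)_{X,Y}\colon\Phi(Y)\otimes\Phi(X)\cong\Phi(X\otimes Y)$ and $\Phi_0\colon\Phi(\mathbf 1)\cong\mathbf 1$, together with a monoidal isomorphism $t\colon\Phi^2\Rightarrow\mathrm{id}_{\mathcal A}$ such that $\Phi(t_X)=t_{\Phi(X)}$. A *$\mathbb Z_2$-braided pair* $(\mathcal A,\mathcal M)$ consists of a braided monoidal category $(\mathcal A,\sigma)$ with an anti-involution for which $\Phi$ is braided, i.e. $\Phi(\sigma_{X,Y})\circ(\Phi_2)_{X,Y}=(\Phi_2)_{Y,X}\circ\sigma_{\Phi(Y),\Phi(X)}$, a right $\mathcal A$-module category $\mathcal M$ (with $a_{M,X,Y}\colon(M\otimes X)\otimes Y\cong M\otimes(X\otimes Y)$ and $r_M\colon M\otimes\mathbf 1\cong M$) with a distinguished object, and a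 natural isomorphism $\kappa_{M,X}\colon M\otimes X\to M\otimes\Phi(X)$ such that, for all $M,X,Y$, * (BP1) $\kappa_{M\otimes X,Y}=a^{-1}\circ(\mathrm{id}_M\otimes\sigma_{\Phi(Y),X})\circ a\circ(\kappa_{M,Y}\otimes\mathrm{id}_X)\circ a^{-1}\circ(\mathrm{id}_M\otimes\sigma_{X,Y})\circ a$; * (BP2) $\kappa_{M,X\otimes Y}=(\mathrm{id}_M\otimes(\Phi_2)_{X,Y})\circ a\circ(\kappa_{M,Y}\otimes\mathrm{id}_{\Phi(X)})\circ a^{-1}\circ(\mathrm{id}_M\otimes\sigma_{\Phi(X),Y})\circ a\circ(\kappa_{M,X}\otimes\mathrm{id}_Y)\circ a^{-1}$. **Structural isomorphisms.** Consider formal composites of the functors $\otimes,\Phi,\mathbf 1$ in variables from a set $I$, denoting functors $\mathcal A^I\to\mathcal A$, and formal composites of the action with these, denoting functors $\mathcal M\times\mathcal A^I\to\mathcal M$. (A variable may be repeated or omitted; words in which each of $n$ variables occurs once give functors on $\mathcal A^{\times n}$ and $\mathcal M\times\mathcal A^{\times n}$.) A *presented structural isomorphism* in $\mathcal A$ is a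 formal vertical and horizontal composite of identities of these functors and $\alpha,\lambda,\rho,\Phi_2,\Phi_0,t,\sigma$ and their inverses; in $\mathcal M$ one may moreover use $\mathrm{id}_{\mathrm{act}},a,r,\kappa$ and their inverses. It denotes a natural isomorphism between the functors denoted by its source and target. Two of them are *parallel* if they have the same formal source and the same formal target. **Underlying braids.** Let $n$ be the number of occurrences of variables of $\mathcal A$ in the source. Let $B_n$ be Artin's braid group with generators $\sigma_1,\dots,\sigma_{n-1}$, and let $B_n^{\mathrm{cyl}}$ be the group generated by $\sigma_1,\dots,\sigma_{n-1}$ and, if $n\ge1$, $\kappa$, with the braid relations among the $\sigma_i$ and $\sigma_1\kappa\sigma_1\kappa=\kappa\sigma_1\kappa\sigma_1$, $\sigma_i\kappa=\kappa\sigma_i$ for $i>1$. Products of braids are read from left to right. The strands of a word are its occurrences of variables, ordered from left to right, except that each application of $\Phi$ reverses the order. The underlying braid $\beta_f$ (in $B_n$ for $f$ in $\mathcal A$, in $B_n^{\mathrm{cyl}}$ for $f$ in $\mathcal M$) is defined on presentations as follows. Vertical composition goes to the product and inversion to the inverse. The identities and $\alpha,\lambda,\rho,\Phi_2,\Phi_0,t,a,r$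 go to $1$. Horizontal composition with $\otimes$ and with the action goes to juxtaposition of strands, and horizontal composition with $\Phi$ on a block of $m$ strands replaces $\sigma_i$ by $\sigma_{m-i}$. If $X$ and $Y$ have $p$ and $q$ strands, $\sigma_{X,Y}$ goes to the positive crossing of the block of the first $p$ strands with the block of the next $q$ strands, which is $\sigma_1$ for $p=q=1$. Finally $\kappa_{M,X}$ goes to the cylinder twist of the corresponding block of strands, which is $\kappa$ if $M$ has no strands and $X$ has one, and which is extended to blocks as prescribed by (BP1) and (BP2); for example it is $\sigma_1\kappa\sigma_1$ if $M$ and $X$ both have one strand, and $\kappa\sigma_1\kappa$ if $M$ has no strands and $X$ has two. **Theorem.** Let $(\mathcal A,\mathcal M)$ be a $\mathbb Z_2$-braided pair, and let $f,g\colon T_1\Rightarrow T_2$ be two parallel presented structural isomorphisms in $\mathcal A$ (respectively in $\mathcal M$). If their underlying braids in $B_n$ (respectively their underlying cylinder braids in $B_n^{\mathrm{cyl}}$) are equal, $\beta_f=\beta_g$, then $f=g$ as natural isomorphisms. -/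

import Mathlib

open CategoryTheory MonoidalCategory
open scoped MonoidalRightAction

universe v₁ v₂ u₁ u₂ w

/-! ### Pairs of a monoidal category and a module category with an involution -/

/-- An anti-involution of a monoidal category `A`: a monoidal functor `(Φ, Φ₂, Φ₀)` from `A` to
`A` with the reversed tensor product `X ⊗ᵒᵖ Y = Y ⊗ X`, and a monoidal isomorphism `t : Φ² ≅ id`
with `Φ(t_X) = t_{Φ X}`.  Note that the associator of the reversed tensor product is
`(α_ Z Y X)⁻¹` and that its left unitor is the right unitor of `A`. -/
structure AntiInvolution (A : Type u₁) [Category.{v₁} A] [MonoidalCategory A] where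
  /-- the underlying functor -/
  Φ : A ⥤ A
  /-- the tensor comparison `Φ X ⊗ᵒᵖ Φ Y ≅ Φ (X ⊗ Y)` -/
  Φ₂ (X Y : A) : Φ.obj Y ⊗ Φ.obj X ≅ Φ.obj (X ⊗ Y)
  Φ₂_natural {X₁ X₂ Y₁ Y₂ : A} (f : X₁ ⟶ X₂) (g : Y₁ ⟶ Y₂) :
    (Φ.map g ⊗ₘ Φ.map f) ≫ (Φ₂ X₂ Y₂).hom = (Φ₂ X₁ Y₁).hom ≫ Φ.map (f ⊗ₘ g)
  /-- the unit comparison -/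
  Φ₀ : Φ.obj (𝟙_ A) ≅ 𝟙_ A
  Φ₂_assoc (X Y Z : A) :
    (Φ.obj Z ◁ (Φ₂ X Y).hom) ≫ (Φ₂ (X ⊗ Y) Z).hom ≫ Φ.map (α_ X Y Z).hom =
      (α_ (Φ.obj Z) (Φ.obj Y) (Φ.obj X)).inv ≫ ((Φ₂ Y Z).hom ▷ Φ.obj X) ≫ (Φ₂ X (Y ⊗ Z)).hom
  Φ₂_unit_left (X : A) :
    (Φ.obj X ◁ Φ₀.hom) ≫ (ρ_ (Φ.obj X)).hom = (Φ₂ (𝟙_ A) X).hom ≫ Φ.map (λ_ X).hom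
  Φ₂_unit_right (X : A) :
    (Φ₀.hom ▷ Φ.obj X) ≫ (λ_ (Φ.obj X)).hom = (Φ₂ X (𝟙_ A)).hom ≫ Φ.map (ρ_ X).hom
  /-- the isomorphism `Φ² ≅ id` -/
  t : Φ ⋙ Φ ≅ 𝟭 A
  t_tensor (X Y : A) :
    (Φ₂ (Φ.obj Y) (Φ.obj X)).hom ≫ Φ.map (Φ₂ X Y).hom ≫ t.hom.app (X ⊗ Y) =
      (t.hom.app X ⊗ₘ t.hom.app Y)
  t_unit : Φ.map Φ₀.hom ≫ Φ₀.hom = t.hom.app (𝟙_ A)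
  map_t (X : A) : Φ.map (t.hom.app X) = t.hom.app (Φ.obj X)

/-- A `ℤ₂`-monoidal pair: a monoidal category `A` with an anti-involution and a pointed right
`A`-module category `M`. -/
structure Z2MonoidalPair (A : Type u₁) [Category.{v₁} A] [MonoidalCategory A]
    (M : Type u₂) [Category.{v₂} M] [MonoidalRightAction A M] extends AntiInvolution A where
  /-- the distinguished object of `M` -/
  point : M

/-- A `ℤ₂`-braided pair: a `ℤ₂`-monoidal pair in which `A` is braided, `Φ` is a braided functor
from `A` to `A` with the reversed tensor product, and which has a cylinder braiding
`κ_{M,X} : M ⊗ X ≅ M ⊗ Φ X`, natural in `M` and `X`, satisfying the axioms BP1 and BP2.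
Here `αᵣ m X Y : m ⊙ᵣ (X ⊗ Y) ≅ (m ⊙ᵣ X) ⊙ᵣ Y` is the inverse of `a_{m,X,Y}`. -/
structure Z2BraidedPair (A : Type u₁) [Category.{v₁} A] [MonoidalCategory A] [BraidedCategory A]
    (M : Type u₂) [Category.{v₂} M] [MonoidalRightAction A M] extends Z2MonoidalPair A M where
  Φ_braided (X Y : A) :
    (Φ₂ X Y).hom ≫ Φ.map (β_ X Y).hom = (β_ (Φ.obj Y) (Φ.obj X)).hom ≫ (Φ₂ Y X).hom
  /-- the cylinder braiding -/
  κ (m : M) (X : A) : m ⊙ᵣ X ≅ m ⊙ᵣ Φ.obj X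
  κ_natural {m₁ m₂ : M} {X₁ X₂ : A} (f : m₁ ⟶ m₂) (g : X₁ ⟶ X₂) :
    (f ⊙ᵣₘ g) ≫ (κ m₂ X₂).hom = (κ m₁ X₁).hom ≫ (f ⊙ᵣₘ Φ.map g)
  BP1 (m : M) (X Y : A) :
    (κ (m ⊙ᵣ X) Y).hom =
      (αᵣ m X Y).inv ≫ (m ⊴ᵣ (β_ X Y).hom) ≫ (αᵣ m Y X).hom ≫ ((κ m Y).hom ⊵ᵣ X) ≫
        (αᵣ m (Φ.obj Y) X).inv ≫ (m ⊴ᵣ (β_ (Φ.obj Y) X).hom) ≫ (αᵣ m X (Φ.obj Y)).hom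
  BP2 (m : M) (X Y : A) :
    (κ m (X ⊗ Y)).hom =
      (αᵣ m X Y).hom ≫ ((κ m X).hom ⊵ᵣ Y) ≫ (αᵣ m (Φ.obj X) Y).inv ≫
        (m ⊴ᵣ (β_ (Φ.obj X) Y).hom) ≫ (αᵣ m Y (Φ.obj X)).hom ≫ ((κ m Y).hom ⊵ᵣ Φ.obj X) ≫
          (αᵣ m (Φ.obj Y) (Φ.obj X)).inv ≫ (m ⊴ᵣ (Φ₂ X Y).hom)

/-! ### Artin braids and cylinder braids -/

/-- The relations of the braid group on `n` strands; the generator with index `i` exchanges the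
strands in the positions `i` and `i + 1`, where positions are counted from `0`. -/
inductive BraidRel (n : ℕ) : FreeGroup (Fin (n - 1)) → Prop
  | braid (i j : Fin (n - 1)) (h : i.val + 1 = j.val) :
      BraidRel n (FreeGroup.of i * FreeGroup.of j * FreeGroup.of i *
        (FreeGroup.of j * FreeGroup.of i * FreeGroup.of j)⁻¹)
  | comm (i j : Fin (n - 1)) (h : i.val + 1 < j.val) :
      BraidRel n (FreeGroup.of i * FreeGroup.of j * (FreeGroup.of j * FreeGroup.of i)⁻¹)

/-- Artin's braid group on `n` strands. -/
abbrev BraidGroup (n : ℕ) : Type := PresentedGroup {r | BraidRel n r}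

/-- The generator of `BraidGroup n` that exchanges the strands in the positions `i` and `i + 1`
(and `1` if there are no such positions). -/
def BraidGroup.σ (n i : ℕ) : BraidGroup n :=
  if h : i < n - 1 then PresentedGroup.of ⟨i, h⟩ else 1

/-- The generators of the cylinder braid group on `n` strands: `κ` takes the strand in position
`0` once around the pole (so it exists only if there is a strand). -/
inductive CylinderGen (n : ℕ) : Type
  | σ (i : Fin (n - 1)) : CylinderGen n
  | κ (h : 0 < n) : CylinderGen n

/-- The relations of the cylinder braid group on `n` strands. -/
inductive CylinderRel (n : ℕ) : FreeGroup (CylinderGen n) → Prop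
  | braid (i j : Fin (n - 1)) (h : i.val + 1 = j.val) :
      CylinderRel n (FreeGroup.of (.σ i) * FreeGroup.of (.σ j) * FreeGroup.of (.σ i) *
        (FreeGroup.of (.σ j) * FreeGroup.of (.σ i) * FreeGroup.of (.σ j))⁻¹)
  | comm (i j : Fin (n - 1)) (h : i.val + 1 < j.val) :
      CylinderRel n (FreeGroup.of (.σ i) * FreeGroup.of (.σ j) *
        (FreeGroup.of (.σ j) * FreeGroup.of (.σ i))⁻¹)
  | reflection (hn : 0 < n) (i : Fin (n - 1)) (h : i.val = 0) :
      CylinderRel n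
        (FreeGroup.of (.σ i) * FreeGroup.of (.κ hn) * FreeGroup.of (.σ i) * FreeGroup.of (.κ hn) *
          (FreeGroup.of (.κ hn) * FreeGroup.of (.σ i) * FreeGroup.of (.κ hn) *
            FreeGroup.of (.σ i))⁻¹)
  | pole (hn : 0 < n) (i : Fin (n - 1)) (h : 0 < i.val) :
      CylinderRel n (FreeGroup.of (.σ i) * FreeGroup.of (.κ hn) *
        (FreeGroup.of (.κ hn) * FreeGroup.of (.σ i))⁻¹)

/-- The cylinder braid group on `n` strands. -/
abbrev CylinderBraidGroup (n : ℕ) : Type := PresentedGroup {r | CylinderRel n r}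

/-- The generator of `CylinderBraidGroup n` that exchanges the strands in the positions `i` and
`i + 1` (and `1` if there are no such positions). -/
def CylinderBraidGroup.σ (n i : ℕ) : CylinderBraidGroup n :=
  if h : i < n - 1 then PresentedGroup.of (.σ ⟨i, h⟩) else 1

/-- The generator `κ` of `CylinderBraidGroup n` (and `1` if there is no strand). -/
def CylinderBraidGroup.κ (n : ℕ) : CylinderBraidGroup n :=
  if h : 0 < n then PresentedGroup.of (.κ h) else 1

/-! ### Block braids

In this section `s i` is a group element that stands for the crossing of the strands in the
positions `i` and `i + 1`, and `k` stands for the cylinder twist of the strand in position `0`.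
A product of braids is read from left to right: `b * c` is `b` followed by `c`. -/

section Blocks

variable {G : Type} [Group G]

/-- The strand in position `p` crosses the strands in the positions `p - 1, …, 0`, one after the
other. -/
def strandBraid (s : ℕ → G) : ℕ → G
  | 0 => 1
  | p + 1 => s p * strandBraid s p

/-- The block of the first `p` strands crosses the block of the next `q` strands: the braid of
`σ_{X,Y}` where `X` has `p` and `Y` has `q` strands. -/
def blockBraid (s : ℕ → G) (p : ℕ) : ℕ → G
  | 0 => 1
  | q + 1 => blockBraid s p q * strandBraid (fun i => s (q + i)) p

/-- The cylinder twist of a block of `q` strands next to the pole, as prescribed by BP2: twist the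
first `q` strands, move the last strand to the pole, twist it.  For `q = 2` this is `κ σ κ`; the
order of the strands of the block is reversed. -/
def poleBlockTwist (s : ℕ → G) (k : G) : ℕ → G
  | 0 => 1
  | q + 1 => poleBlockTwist s k q * blockBraid s q 1 * k

/-- The cylinder twist of the block of `q` strands that follows the first `p` strands, as
prescribed by BP1: move the block to the pole, twist it, move it back.  This is the braid of
`κ_{m,X}` where `m` has `p` and `X` has `q` strands. -/
def blockTwist (s : ℕ → G) (k : G) (p q : ℕ) : G :=
  blockBraid s p q * poleBlockTwist s k q * blockBraid s q p

end Blocks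

/-! ### Formal composite functors -/

/-- Formal composites of the functors `⊗`, `Φ`, `𝟙` in variables from `ι`, which stand for the
functors `Aᶥ ⥤ A` built from the structure of `A`.  Words in which each variable from `Fin n`
occurs exactly once give the composite functors `Aⁿ ⥤ A` with permuted arguments. -/
inductive TensorWord (ι : Type w) : Type w
  | var (i : ι) : TensorWord ι
  | unit : TensorWord ι
  | tensor (S T : TensorWord ι) : TensorWord ι
  | phi (S : TensorWord ι) : TensorWord ι

/-- The number of strands of a word. -/
def TensorWord.length {ι : Type w} : TensorWord ι → ℕ
  | .var _ => 1
  | .unit => 0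
  | .tensor S T => S.length + T.length
  | .phi S => S.length

/-- Formal composites of the action functor with words, which stand for the functors
`M × Aᶥ ⥤ M` built from the structure of the pair; `base` is the argument in `M`. -/
inductive ModuleWord (ι : Type w) : Type w
  | base : ModuleWord ι
  | act (m : ModuleWord ι) (S : TensorWord ι) : ModuleWord ι

/-- The number of strands of a module word; the pole is not counted. -/
def ModuleWord.length {ι : Type w} : ModuleWord ι → ℕ
  | .base => 0
  | .act m S => m.length + S.length

/-! ### Presentations of structural isomorphisms -/

/-- Presentations of structural isomorphisms in `A`, as vertical (`comp`) and horizontal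
composites.  Horizontal composites `id_⊗ * (f, g)` and `id_Φ * f` are `tensor f g` and `phi f`.
The generating isomorphisms are given at arbitrary words, that is, composed horizontally with
identities; a general horizontal composite, such as
`σ * (f, g) = (id_⊗ * (g, f)) ∘ (σ * (id, id))`, is a composite of these. -/
inductive StructuralIso {ι : Type w} : TensorWord ι → TensorWord ι → Type w
  | id (S : TensorWord ι) : StructuralIso S S
  | comp {S T U : TensorWord ι} (f : StructuralIso S T) (g : StructuralIso T U) :
      StructuralIso S U
  | inv {S T : TensorWord ι} (f : StructuralIso S T) : StructuralIso T S
  | tensor {S₁ T₁ S₂ T₂ : TensorWord ι} (f : StructuralIso S₁ T₁) (g : StructuralIso S₂ T₂) :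
      StructuralIso (.tensor S₁ S₂) (.tensor T₁ T₂)
  | phi {S T : TensorWord ι} (f : StructuralIso S T) : StructuralIso (.phi S) (.phi T)
  | α (S T U : TensorWord ι) :
      StructuralIso (.tensor (.tensor S T) U) (.tensor S (.tensor T U))
  | lam (S : TensorWord ι) : StructuralIso (.tensor .unit S) S
  | rho (S : TensorWord ι) : StructuralIso (.tensor S .unit) S
  | Φ₂ (S T : TensorWord ι) : StructuralIso (.tensor (.phi T) (.phi S)) (.phi (.tensor S T))
  | Φ₀ : StructuralIso (.phi .unit) .unit
  | t (S : TensorWord ι) : StructuralIso (.phi (.phi S)) S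
  | σ (S T : TensorWord ι) : StructuralIso (.tensor S T) (.tensor T S)

/-- Presentations of structural isomorphisms in `M`; `act f g` is the horizontal composite
`id_act * (f, g)`. -/
inductive ModuleStructuralIso {ι : Type w} : ModuleWord ι → ModuleWord ι → Type w
  | id (m : ModuleWord ι) : ModuleStructuralIso m m
  | comp {m n p : ModuleWord ι} (f : ModuleStructuralIso m n) (g : ModuleStructuralIso n p) :
      ModuleStructuralIso m p
  | inv {m n : ModuleWord ι} (f : ModuleStructuralIso m n) : ModuleStructuralIso n m
  | act {m n : ModuleWord ι} {S T : TensorWord ι} (f : ModuleStructuralIso m n)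
      (g : StructuralIso S T) : ModuleStructuralIso (.act m S) (.act n T)
  | a (m : ModuleWord ι) (S T : TensorWord ι) :
      ModuleStructuralIso (.act (.act m S) T) (.act m (.tensor S T))
  | r (m : ModuleWord ι) : ModuleStructuralIso (.act m .unit) m
  | κ (m : ModuleWord ι) (S : TensorWord ι) :
      ModuleStructuralIso (.act m S) (.act m (.phi S))

/-! ### Underlying braids -/

/-- The braid of a presentation in `A`, where `s i` is the crossing of the strands in the
positions `i` and `i + 1` of the word.  In `tensor f g` the strands of `g` stand to the right of
those of `f`.  As `Φ` reverses tensor products, the strands of `phi S` are those of `S` in the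
opposite order, so that the crossing in position `i` of `S` becomes the one in position
`S.length - 2 - i` of `phi S`. -/
def StructuralIso.braidWith {ι : Type w} {G : Type} [Group G] :
    {S T : TensorWord ι} → (ℕ → G) → StructuralIso S T → G
  | _, _, _, .id _ => 1
  | _, _, s, .comp f g => f.braidWith s * g.braidWith s
  | _, _, s, .inv f => (f.braidWith s)⁻¹
  | .tensor S₁ _, _, s, .tensor f g => f.braidWith s * g.braidWith (fun i => s (S₁.length + i))
  | .phi S, _, s, .phi f => f.braidWith (fun i => s (S.length - 2 - i))
  | _, _, _, .α _ _ _ => 1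
  | _, _, _, .lam _ => 1
  | _, _, _, .rho _ => 1
  | _, _, _, .Φ₂ _ _ => 1
  | _, _, _, .Φ₀ => 1
  | _, _, _, .t _ => 1
  | _, _, s, .σ S T => blockBraid s S.length T.length

/-- The underlying braid of a presentation in `A`, on as many strands as its source has. -/
def StructuralIso.braid {ι : Type w} {S T : TensorWord ι} (f : StructuralIso S T) :
    BraidGroup S.length :=
  f.braidWith (BraidGroup.σ S.length)

/-- The braid of a presentation in `M`, where `s i` is the crossing of the strands in the
positions `i` and `i + 1` of the word and `k` the cylinder twist of the strand in position `0`. -/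
def ModuleStructuralIso.braidWith {ι : Type w} {G : Type} [Group G] (s : ℕ → G) (k : G) :
    {m n : ModuleWord ι} → ModuleStructuralIso m n → G
  | _, _, .id _ => 1
  | _, _, .comp f g => f.braidWith s k * g.braidWith s k
  | _, _, .inv f => (f.braidWith s k)⁻¹
  | .act m _, _, .act f g => f.braidWith s k * g.braidWith (fun i => s (m.length + i))
  | _, _, .a _ _ _ => 1
  | _, _, .r _ => 1
  | _, _, .κ m S => blockTwist s k m.length S.length

/-- The underlying cylinder braid of a presentation in `M`, on as many strands as its source
has. -/
def ModuleStructuralIso.cylinderBraid {ι : Type w} {m n : ModuleWord ι}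
    (f : ModuleStructuralIso m n) : CylinderBraidGroup m.length :=
  f.braidWith (CylinderBraidGroup.σ m.length) (CylinderBraidGroup.κ m.length)

/-! ### The natural isomorphisms that presentations denote -/

section Evaluation

variable {A : Type u₁} [Category.{v₁} A] [MonoidalCategory A]
variable {M : Type u₂} [Category.{v₂} M] [MonoidalRightAction A M]
variable {ι : Type w}

/-- The functor `Aᶥ ⥤ A` denoted by a word. -/
def TensorWord.functor (P : AntiInvolution A) : TensorWord ι → ((ι → A) ⥤ A)
  | .var i => Pi.eval (fun _ => A) i
  | .unit => (Functor.const (ι → A)).obj (𝟙_ A)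
  | .tensor S T =>
    { obj := fun X => (S.functor P).obj X ⊗ (T.functor P).obj X
      map := fun f => (S.functor P).map f ⊗ₘ (T.functor P).map f }
  | .phi S => S.functor P ⋙ P.Φ

/-- The functor `M × Aᶥ ⥤ M` denoted by a module word. -/
def ModuleWord.functor (P : AntiInvolution A) : ModuleWord ι → (M × (ι → A) ⥤ M)
  | .base => CategoryTheory.Prod.fst M (ι → A)
  | .act m S =>
    { obj := fun X => (m.functor P).obj X ⊙ᵣ (S.functor P).obj X.2
      map := fun f => (m.functor P).map f ⊙ᵣₘ (S.functor P).map f.2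
      map_comp := fun f g => by
        rw [prod_comp_snd, Functor.map_comp, Functor.map_comp, MonoidalRightAction.actionHom_comp] }

/-- The action of a pair of isomorphisms. -/
@[simps]
def actIso {m n : M} {X Y : A} (f : m ≅ n) (g : X ≅ Y) : m ⊙ᵣ X ≅ n ⊙ᵣ Y where
  hom := f.hom ⊙ᵣₘ g.hom
  inv := f.inv ⊙ᵣₘ g.inv
  hom_inv_id := by simp [← MonoidalRightAction.actionHom_comp]
  inv_hom_id := by simp [← MonoidalRightAction.actionHom_comp]

variable [BraidedCategory A]

/-- The natural isomorphism in `A` denoted by a presentation. -/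
def StructuralIso.natIso (P : AntiInvolution A) :
    {S T : TensorWord ι} → StructuralIso S T → (S.functor P ≅ T.functor P)
  | _, _, .id S => Iso.refl (S.functor P)
  | _, _, .comp f g => f.natIso P ≪≫ g.natIso P
  | _, _, .inv f => (f.natIso P).symm
  | _, _, .tensor f g =>
    NatIso.ofComponents (fun X => (f.natIso P).app X ⊗ᵢ (g.natIso P).app X) (by
      intro X Y h
      simp [TensorWord.functor, tensorHom_comp_tensorHom])
  | _, _, .phi f => Functor.isoWhiskerRight (f.natIso P) P.Φ
  | _, _, .α S T U =>
    NatIso.ofComponents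
      (fun X => α_ ((S.functor P).obj X) ((T.functor P).obj X) ((U.functor P).obj X)) (by
      intro X Y h
      simp [TensorWord.functor])
  | _, _, .lam S =>
    NatIso.ofComponents (fun X => λ_ ((S.functor P).obj X)) (by
      intro X Y h
      simp [TensorWord.functor])
  | _, _, .rho S =>
    NatIso.ofComponents (fun X => ρ_ ((S.functor P).obj X)) (by
      intro X Y h
      simp [TensorWord.functor])
  | _, _, .Φ₂ S T =>
    NatIso.ofComponents (fun X => P.Φ₂ ((S.functor P).obj X) ((T.functor P).obj X)) (by
      intro X Y h
      exact P.Φ₂_natural _ _)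
  | _, _, .Φ₀ =>
    NatIso.ofComponents (fun _ => P.Φ₀) (by
      intro X Y h
      simp [TensorWord.functor])
  | _, _, .t S => Functor.isoWhiskerLeft (S.functor P) P.t
  | _, _, .σ S T =>
    NatIso.ofComponents (fun X => β_ ((S.functor P).obj X) ((T.functor P).obj X)) (by
      intro X Y h
      simp [TensorWord.functor])

/-- The natural isomorphism in `M` denoted by a presentation. -/
def ModuleStructuralIso.natIso (P : Z2BraidedPair A M) :
    {m n : ModuleWord ι} → ModuleStructuralIso m n →
      ((m.functor P.toAntiInvolution : M × (ι → A) ⥤ M) ≅ n.functor P.toAntiInvolution)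
  | _, _, .id m => Iso.refl (m.functor P.toAntiInvolution)
  | _, _, .comp f g => f.natIso P ≪≫ g.natIso P
  | _, _, .inv f => (f.natIso P).symm
  | _, _, .act f g =>
    NatIso.ofComponents
      (fun X => actIso ((f.natIso P).app X) ((g.natIso P.toAntiInvolution).app X.2)) (by
      intro X Y h
      exact (MonoidalRightAction.actionHom_comp _ _ _ _).symm.trans
        ((congrArg₂ (fun p q => p ⊙ᵣₘ q) ((f.natIso P).hom.naturality h)
          ((g.natIso P.toAntiInvolution).hom.naturality h.2)).trans
            (MonoidalRightAction.actionHom_comp _ _ _ _)))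
  | _, _, .a m S T =>
    NatIso.ofComponents
      (fun X => (αᵣ ((m.functor P.toAntiInvolution).obj X)
        ((S.functor P.toAntiInvolution).obj X.2) ((T.functor P.toAntiInvolution).obj X.2)).symm) (by
      intro X Y h
      simp only [ModuleWord.functor, TensorWord.functor, Iso.symm_hom]
      rw [Iso.comp_inv_eq, Category.assoc, MonoidalRightAction.actionAssocIso_hom_naturality,
        Iso.inv_hom_id_assoc])
  | _, _, .r m =>
    NatIso.ofComponents (fun X => ρᵣ ((m.functor P.toAntiInvolution).obj X)) (by
      intro X Y h
      simp [ModuleWord.functor, TensorWord.functor])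
  | _, _, .κ m S =>
    NatIso.ofComponents
      (fun X => P.κ ((m.functor P.toAntiInvolution).obj X)
        ((S.functor P.toAntiInvolution).obj X.2)) (by
      intro X Y h
      exact P.κ_natural _ _)

end Evaluation

/-! ### Algebra of block braids -/

section BlockAlgebra

variable {G : Type} [Group G]

/-! Every word has a normal form. Pushing `Φ` inwards (it reverses tensor products, and two
applications cancel through `t`) turns the action of a word on an object `b` into the successive
action of signed variables, its strands. `TensorWord.toStrands` and `ModuleWord.toStrands` are the
resulting isomorphisms, so a structural isomorphism becomes, after conjugation, an isomorphism
between objects of strands.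

On the strand side only two elementary moves remain: the crossing of neighbours, given by the
braiding, and the cylinder twist of the strand beside the pole, given by `κ`. A braid group acts by
a group, while these moves change the list of letters. They are therefore made into permutations of
the set of all morphisms from a fixed `Y` to objects of `n` strands. These permutations satisfy the
braid relations. Distant moves commute by naturality, the Artin relation is Yang–Baxter
(`crossIso_yang_baxter`), and the reflection equation is naturality of `κ` in its module argument
combined with BP1 (`crossing_twist_reflection`). Hence the (cylinder) braid group acts.

The core is an induction over presentations (`StructuralIso.realizes`,
`ModuleStructuralIso.realizes`): the underlying braid acts as composition with the conjugated
isomorphism. Each coherence axiom says that some generator becomes an identity between strands, the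
hexagons decompose block crossings, and BP1 and BP2 decompose block twists. Equal braids then act
equally, and letting them act on an identity morphism recovers the isomorphism (`Realizes.hom_ext`).
The statement in `A` is obtained by letting `A` act on itself with `b` the unit. -/

theorem strandBraid_add (s : ℕ → G) (p q : ℕ) :
    strandBraid s (p + q) = strandBraid (fun i => s (p + i)) q * strandBraid s p := by
  induction q with
  | zero => simp [strandBraid]
  | succ q ih => rw [← Nat.add_assoc, strandBraid, ih, strandBraid, mul_assoc]

@[simp]
theorem blockBraid_one (s : ℕ → G) (p : ℕ) : blockBraid s p 1 = strandBraid s p := by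
  simp [blockBraid]

@[simp]
theorem blockBraid_zero_left (s : ℕ → G) (q : ℕ) : blockBraid s 0 q = 1 := by
  induction q with
  | zero => rfl
  | succ q ih => simp [blockBraid, ih, strandBraid]

theorem blockBraid_add_right (s : ℕ → G) (p q r : ℕ) :
    blockBraid s p (q + r) = blockBraid s p q * blockBraid (fun i => s (q + i)) p r := by
  induction r with
  | zero => simp [blockBraid]
  | succ r ih =>
    rw [← Nat.add_assoc, blockBraid, ih, blockBraid]
    simp only [mul_assoc, Nat.add_assoc]

variable {K : Type*} [Group K] (φ : G →* K)

/-- Here and below, commutation is asked only of images under `φ`, and only at indices of strands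
that are present: `G` is arbitrary, and the relations will be known among permutations of strands.
-/
theorem commute_strandBraid {x : K} {s : ℕ → G} {p : ℕ} (h : ∀ i < p, Commute x (φ (s i))) :
    Commute x (φ (strandBraid s p)) := by
  induction p with
  | zero => simp [strandBraid]
  | succ p ih =>
    rw [strandBraid, map_mul]
    exact (h p p.lt_succ_self).mul_right (ih fun i hi => h i (hi.trans p.lt_succ_self))

theorem commute_blockBraid {x : K} {s : ℕ → G} {p q : ℕ}
    (h : ∀ i, i + 1 < p + q → Commute x (φ (s i))) :
    Commute x (φ (blockBraid s p q)) := by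
  induction q with
  | zero => simp [blockBraid]
  | succ q ih =>
    rw [blockBraid, map_mul]
    exact (ih fun i hi => h i (by lia)).mul_right
      (commute_strandBraid φ fun i hi => h _ (by lia))

/-- The image under `φ` of the block braid of two blocks, where the first block is divided. -/
theorem blockBraid_add_left {s : ℕ → G} {p r q : ℕ}
    (h : ∀ i j, i + 1 < j → j + 1 < p + r + q → Commute (φ (s i)) (φ (s j))) :
    φ (blockBraid s (p + r) q) =
      φ (blockBraid (fun i => s (p + i)) r q) * φ (blockBraid s p q) := by
  induction q with
  | zero => simp [blockBraid]
  | succ q ih =>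
    -- The first factor involves indices up to `p + q - 2`, the second only indices from `p + q` on.
    have hc : Commute (φ (blockBraid s p q)) (φ (strandBraid (fun i => s (p + (q + i))) r)) :=
      commute_strandBraid φ fun i hi =>
        (commute_blockBraid φ fun j hj => (h j _ (by lia) (by lia)).symm).symm
    have e : (fun i => s (q + (p + i))) = fun i => s (p + (q + i)) := by
      funext i; congr 1; lia
    simp only [blockBraid, map_mul, strandBraid_add, e, ih fun i j hi hj => h i j hi (by lia)]
    simp only [mul_assoc]
    rw [← mul_assoc (φ (blockBraid s p q)), hc.eq, mul_assoc]

/-- Reversing the indices turns the descending product `s (p - 1) ⋯ s 0` into the ascending one. -/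
theorem map_strandBraid_reflect {s s' : ℕ → G} {p : ℕ}
    (hs : ∀ i < p, φ (s' i) = φ (s (p - 1 - i))) :
    φ (strandBraid s' p) = φ (blockBraid s 1 p) := by
  induction p generalizing s with
  | zero => simp [blockBraid, strandBraid]
  | succ p ih =>
    rw [Nat.add_comm p 1, blockBraid_add_right, Nat.add_comm 1 p, strandBraid, map_mul, map_mul,
      ih (s := fun i => s (1 + i)) (fun i hi => by rw [hs i (by lia)]; congr 2; lia),
      hs p (by lia)]
    simp [strandBraid]

/-- Reflection turns the crossing of `p` strands with `q` strands into the crossing of `q`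
strands with `p` strands. -/
theorem map_blockBraid_reflect {s s' : ℕ → G} {p q : ℕ}
    (hs : ∀ i, i + 1 < p + q → φ (s' i) = φ (s (p + q - 2 - i)))
    (h : ∀ i j, i + 1 < j → j + 1 < p + q → Commute (φ (s i)) (φ (s j))) :
    φ (blockBraid s' p q) = φ (blockBraid s q p) := by
  induction q generalizing s with
  | zero => simp [blockBraid]
  | succ q ih =>
    rw [blockBraid, map_mul, Nat.add_comm q 1,
      blockBraid_add_left φ fun i j hi hj => h i j hi (by lia),
      ih (s := fun i => s (1 + i)) (fun i hi => by rw [hs i (by lia)]; congr 2; lia)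
        (fun i j hi hj => h _ _ (by lia) (by lia)),
      map_strandBraid_reflect φ (s := s)
        (fun i hi => by rw [hs _ (by lia)]; congr 2; lia)]

theorem commute_poleBlockTwist {x : K} {s : ℕ → G} {k : G} {q : ℕ}
    (hk : 0 < q → Commute x (φ k)) (h : ∀ i, i + 1 < q → Commute x (φ (s i))) :
    Commute x (φ (poleBlockTwist s k q)) := by
  induction q with
  | zero => simp [poleBlockTwist]
  | succ q ih =>
    rw [poleBlockTwist, map_mul, map_mul]
    exact ((ih (fun _ => hk (by lia)) fun i hi => h i (by lia)).mul_right
      (commute_blockBraid φ fun i hi => h i hi)).mul_right (hk (by lia))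

/-- The block form of BP2. The definition adds one strand at a time; the new strand passes the block
of `p` strands at indices from `q` on, and this commutes with the twist of the `q` strands at the
pole. -/
theorem poleBlockTwist_add {s : ℕ → G} {k : G} {p q : ℕ}
    (h : ∀ i j, i + 1 < j → j + 1 < p + q → Commute (φ (s i)) (φ (s j)))
    (hk : ∀ i, 0 < i → i + 1 < p + q → Commute (φ k) (φ (s i))) :
    φ (poleBlockTwist s k (p + q)) =
      φ (poleBlockTwist s k p) * φ (blockBraid s p q) * φ (poleBlockTwist s k q) := by
  induction q with
  | zero => simp [blockBraid, poleBlockTwist]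
  | succ q ih =>
    have hc : Commute (φ (poleBlockTwist s k q))
        (φ (strandBraid (fun i => s (q + i)) p)) :=
      commute_strandBraid φ fun i hi =>
        (commute_poleBlockTwist φ (fun hq => (hk _ (by lia) (by lia)).symm)
          fun j hj => (h j _ (by lia) (by lia)).symm).symm
    rw [← Nat.add_assoc, poleBlockTwist, blockBraid_one, Nat.add_comm p q, strandBraid_add,
      Nat.add_comm q p, map_mul, map_mul, map_mul, ih (fun i j hi hj => h i j hi (by lia))
      (fun i hi hj => hk i hi (by lia)), poleBlockTwist, blockBraid_one, blockBraid]
    simp only [map_mul, mul_assoc]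
    rw [← mul_assoc (φ (poleBlockTwist s k q)), hc.eq, mul_assoc]

/-- One step of BP1: the block passes the outermost of the preceding strands first on its way to the
pole and last on its way back. -/
theorem blockTwist_succ {s : ℕ → G} (k : G) {p q : ℕ}
    (h : ∀ i j, i + 1 < j → j + 1 < p + 1 + q → Commute (φ (s i)) (φ (s j))) :
    φ (blockTwist s k (p + 1) q) =
      φ (blockBraid (fun i => s (p + i)) 1 q) * φ (blockTwist s k p q) *
        φ (blockBraid (fun i => s (p + i)) q 1) := by
  simp only [blockTwist, map_mul, blockBraid_add_left φ h, blockBraid_add_right s q p 1, mul_assoc]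

theorem blockTwist_zero (s : ℕ → G) (k : G) (q : ℕ) :
    blockTwist s k 0 q = poleBlockTwist s k q := by
  simp [blockTwist, blockBraid]

end BlockAlgebra

/-! ### Strands beside the pole -/

section Strands

variable {A : Type u₁} [Category.{v₁} A] [MonoidalCategory A]
variable {M : Type u₂} [Category.{v₂} M] [MonoidalRightAction A M]
variable {Λ : Type w} (L : Λ → A) (b : M)

/-- The object obtained from `b` by acting with the objects that the letters of a list denote; the
head of the list acts last. -/
def strands : List Λ → M
  | [] => b
  | x :: w => strands w ⊙ᵣ L x

/-- A family of isomorphisms between objects of strands, along an involution of lists of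
letters. -/
structure StrandMove where
  list : List Λ → List Λ
  length_list (w : List Λ) : (list w).length = w.length
  list_list (w : List Λ) : list (list w) = w
  iso (w : List Λ) : strands L b w ≅ strands L b (list w)

variable {L b}

namespace StrandMove

/-- The move below the last strand. -/
def under (F : StrandMove L b) : StrandMove L b where
  list
    | [] => []
    | x :: w => x :: F.list w
  length_list
    | [] => rfl
    | _ :: w => congrArg (· + 1) (F.length_list w)
  list_list
    | [] => rfl
    | x :: w => congrArg (x :: ·) (F.list_list w)
  iso
    | [] => Iso.refl _
    | x :: w => actIso (F.iso w) (Iso.refl (L x))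

/-- The move below the last `d` strands. -/
def lower : ℕ → StrandMove L b → StrandMove L b
  | 0, F => F
  | d + 1, F => lower d F.under

end StrandMove

theorem length_reverseAux (v w : List Λ) : (v.reverseAux w).length = v.length + w.length := by
  simp [List.reverseAux_eq]

/-- A morphism between objects of strands, with further strands acting afterwards. -/
def extend : (v : List Λ) → {w w' : List Λ} → (strands L b w ⟶ strands L b w') →
    (strands L b (v.reverseAux w) ⟶ strands L b (v.reverseAux w'))
  | [], _, _, h => h
  -- `(x :: v).reverseAux w` unfolds to `v.reverseAux (x :: w)`, so the types match without
  -- transport.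
  | x :: v, _, _, h => extend v (w := x :: _) (w' := x :: _) (h ⊵ᵣ L x)

theorem extend_id (v w : List Λ) : extend v (𝟙 (strands L b w)) = 𝟙 _ := by
  induction v generalizing w with
  | nil => rfl
  | cons x v ih =>
    rw [extend, MonoidalRightAction.id_actionHomLeft]
    exact ih (x :: w)

theorem extend_comp (v : List Λ) {w w' w'' : List Λ} (h : strands L b w ⟶ strands L b w')
    (h' : strands L b w' ⟶ strands L b w'') :
    extend v (h ≫ h') = extend v h ≫ extend v h' := by
  induction v generalizing w w' w'' with
  | nil => rfl
  | cons x v ih =>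
    rw [extend, MonoidalRightAction.comp_actionHomLeft]
    exact ih (w := x :: w) (w' := x :: w') (w'' := x :: w'') _ _

/-- The two target lists agree only propositionally; pairing each morphism with its target avoids
transport. -/
theorem StrandMove.lower_reverseAux (F : StrandMove L b) (v w : List Λ) :
    (⟨_, ((F.lower v.length).iso (v.reverseAux w)).hom⟩ :
      Σ w', strands L b (v.reverseAux w) ⟶ strands L b w') =
      ⟨v.reverseAux (F.list w), extend v (F.iso w).hom⟩ := by
  induction v generalizing F w with
  | nil => rfl
  | cons x v ih =>
    refine (ih F.under (x :: w)).trans ?_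
    have : (F.under.iso (x :: w)).hom = (F.iso w).hom ⊵ᵣ L x :=
      MonoidalRightAction.actionHom_id _ _
    rw [this]
    rfl

variable (L b) in
/-- The group of permutations of the morphisms from `Y` to objects of `n` strands, with products
read from left to right. -/
abbrev StrandGroup (n : ℕ) (Y : M) : Type _ :=
  (Equiv.Perm (Σ w : {w : List Λ // w.length = n}, Y ⟶ strands L b w.1))ᵐᵒᵖ

variable {n : ℕ} {Y : M}

/-- The permutation that a move induces by composition. -/
def StrandMove.perm (F : StrandMove L b) (n : ℕ) (Y : M) : StrandGroup L b n Y :=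
  MulOpposite.op <| Equiv.sigmaCongr
    { toFun := fun w => ⟨F.list w.1, (F.length_list w.1).trans w.2⟩
      invFun := fun w => ⟨F.list w.1, (F.length_list w.1).trans w.2⟩
      -- Only the effect on lists is involutive; the isomorphisms themselves need not be.
      left_inv := fun w => Subtype.ext (F.list_list w.1)
      right_inv := fun w => Subtype.ext (F.list_list w.1) }
    fun w => Iso.homCongr (Iso.refl Y) (F.iso w.1)

/-- The group element `g` acts by composition with `h`. -/
def Acts (g : StrandGroup L b n Y) {w w' : List Λ} (h : strands L b w ⟶ strands L b w') : Prop :=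
  ∃ (hw : w.length = n) (hw' : w'.length = n), ∀ k : Y ⟶ strands L b w,
    g.unop ⟨⟨w, hw⟩, k⟩ = ⟨⟨w', hw'⟩, k ≫ h⟩

/-- The group element `g` acts by composition with `h`, with all further strands fixed. -/
def Realizes (g : StrandGroup L b n Y) {w w' : List Λ}
    (h : strands L b w ⟶ strands L b w') : Prop :=
  w.length = w'.length ∧ ∀ v : List Λ, (v.reverseAux w).length = n → Acts g (extend v h)

namespace Realizes

variable {w w' w'' : List Λ} {g g' : StrandGroup L b n Y}

theorem one (w : List Λ) : Realizes (1 : StrandGroup L b n Y) (𝟙 (strands L b w)) :=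
  ⟨rfl, fun v hv => ⟨hv, hv, fun k => by rw [extend_id, Category.comp_id]; rfl⟩⟩

theorem of_eq {h h' : strands L b w ⟶ strands L b w'} (H : Realizes g h) (e : h = h') :
    Realizes g h' := e ▸ H

theorem mul {h : strands L b w ⟶ strands L b w'} {h' : strands L b w' ⟶ strands L b w''}
    (H : Realizes g h) (H' : Realizes g' h') : Realizes (g * g') (h ≫ h') := by
  refine ⟨H.1.trans H'.1, fun v hv => ?_⟩
  obtain ⟨_, hw', e⟩ := H.2 v hv
  obtain ⟨_, hw'', e'⟩ := H'.2 v hw'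
  refine ⟨hv, hw'', fun k => ?_⟩
  rw [MulOpposite.unop_mul, Equiv.Perm.mul_apply, e, e', extend_comp, Category.assoc]

theorem inv {h : strands L b w ≅ strands L b w'} (H : Realizes g h.hom) : Realizes g⁻¹ h.inv := by
  refine ⟨H.1.symm, fun v hv => ?_⟩
  obtain ⟨hw, hw', e⟩ := H.2 v (by
    rw [length_reverseAux] at hv ⊢
    rw [H.1, hv])
  refine ⟨hw', hw, fun k => ?_⟩
  rw [MulOpposite.unop_inv, Equiv.Perm.inv_eq_iff_eq, e, Category.assoc, ← extend_comp,
    h.inv_hom_id, extend_id, Category.comp_id]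

theorem whiskerRight {h : strands L b w ⟶ strands L b w'} (H : Realizes g h) (x : Λ) :
    Realizes g (w := x :: w) (w' := x :: w') (h ⊵ᵣ L x) :=
  ⟨congrArg (· + 1) H.1, fun v hv => H.2 (x :: v) hv⟩

/-- No list `v` completes `w` to `n` strands. This disposes of the cases in which the relations
among crossings are not available. -/
theorem of_length_lt {h : strands L b w ⟶ strands L b w'} (hn : n < w.length)
    (hw : w.length = w'.length) : Realizes g h :=
  ⟨hw, fun v hv => by rw [length_reverseAux] at hv; lia⟩

/-- A Yoneda argument: with `Y` the source itself, `g` sends the identity to the morphism that it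
realizes. -/
theorem hom_ext {g : StrandGroup L b n (strands L b w)} {h h' : strands L b w ⟶ strands L b w'}
    (hw : w.length = n) (H : Realizes g h) (H' : Realizes g h') : h = h' := by
  obtain ⟨_, hw', e⟩ := H.2 [] hw
  obtain ⟨_, _, e'⟩ := H'.2 [] hw
  have := eq_of_heq (Sigma.mk.inj ((e (𝟙 _)).symm.trans (e' (𝟙 _)))).2
  exact (Category.id_comp _).symm.trans (this.trans (Category.id_comp _))

end Realizes

/-- Reduces a relation between group elements to an identity of morphisms on the `m` strands nearest
the pole. -/
theorem StrandGroup.ext_of_realizes {g g' : StrandGroup L b n Y} (m : ℕ) (hm : m ≤ n)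
    (H : ∀ w : List Λ, w.length = m →
      ∃ (w' : List Λ) (h : strands L b w ⟶ strands L b w'), Realizes g h ∧ Realizes g' h) :
    g = g' := by
  refine MulOpposite.unop_injective (Equiv.ext ?_)
  rintro ⟨⟨u, hu⟩, k⟩
  obtain ⟨v, w, rfl, hw⟩ : ∃ v w : List Λ, v.reverseAux w = u ∧ w.length = m :=
    -- The head of a list acts last, so the strands nearest the pole are at its end.
    ⟨(u.take (n - m)).reverse, u.drop (n - m), by simp [List.reverseAux_eq], by simp; lia⟩
  obtain ⟨w', h, H, H'⟩ := H w hw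
  obtain ⟨_, _, e⟩ := H.2 v hu
  obtain ⟨_, _, e'⟩ := H'.2 v hu
  rw [e, e']

theorem exists_realizes_of_le {g : StrandGroup L b n Y} {p : ℕ}
    (H : ∀ w : List Λ, w.length = p →
      ∃ (w' : List Λ) (h : strands L b w ⟶ strands L b w'), Realizes g h)
    (w : List Λ) (hw : p ≤ w.length) :
    ∃ (w' : List Λ) (h : strands L b w ⟶ strands L b w'), Realizes g h := by
  induction w with
  | nil => exact H [] (by simpa [eq_comm] using hw)
  | cons x w ih =>
    rcases hw.eq_or_lt with hw | hw
    · exact H _ hw.symm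
    · obtain ⟨w', h, r⟩ := ih (Nat.lt_succ_iff.1 hw)
      exact ⟨x :: w', _, r.whiskerRight x⟩

theorem StrandMove.realizes_perm (F : StrandMove L b) (w : List Λ) :
    Realizes ((F.lower (n - w.length)).perm n Y) (F.iso w).hom := by
  refine ⟨(F.length_list w).symm, fun v hv => ⟨hv, ?_, fun k => ?_⟩⟩
  · rw [length_reverseAux] at hv ⊢
    rw [F.length_list, hv]
  · have hd : n - w.length = v.length := by rw [length_reverseAux] at hv; lia
    rw [hd]
    have H := F.lower_reverseAux v w
    have key : ∀ (z : Σ w', strands L b (v.reverseAux w) ⟶ strands L b w')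
        (hz : z.1.length = n) (z' : Σ w', strands L b (v.reverseAux w) ⟶ strands L b w')
        (hz' : z'.1.length = n), z = z' →
        (⟨⟨z.1, hz⟩, k ≫ z.2⟩ : Σ w : {w : List Λ // w.length = n}, Y ⟶ strands L b w.1) =
          ⟨⟨z'.1, hz'⟩, k ≫ z'.2⟩ := by
      rintro z hz _ hz' rfl
      rfl
    refine Eq.trans ?_ (key _ ?_ _ ?_ H)
    · simp [StrandMove.perm, Equiv.sigmaCongr, Iso.homCongr]
    · exact ((F.lower v.length).length_list _).trans hv
    · exact (congrArg (fun z => z.1.length) H).symm.trans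
        (((F.lower v.length).length_list _).trans hv)

section Braided

variable [BraidedCategory A]

/-- The crossing of the last two strands. -/
def crossIso (m : M) (X Y : A) : (m ⊙ᵣ X) ⊙ᵣ Y ≅ (m ⊙ᵣ Y) ⊙ᵣ X :=
  (αᵣ m X Y).symm ≪≫ actIso (Iso.refl m) (β_ X Y) ≪≫ αᵣ m Y X

theorem crossIso_hom (m : M) (X Y : A) :
    (crossIso m X Y).hom = (αᵣ m X Y).inv ≫ m ⊴ᵣ (β_ X Y).hom ≫ (αᵣ m Y X).hom := by
  simp [crossIso]

variable (L b) in
/-- The crossing of the last two strands, as a move. -/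
def crossMove : StrandMove L b where
  list
    | x :: y :: w => y :: x :: w
    | w => w
  length_list
    | _ :: _ :: _ => rfl
    | [_] => rfl
    | [] => rfl
  list_list
    | _ :: _ :: _ => rfl
    | [_] => rfl
    | [] => rfl
  iso
    | x :: y :: w => crossIso (strands L b w) (L y) (L x)
    | [_] => Iso.refl _
    | [] => Iso.refl _

variable (L b n Y) in
/-- The crossing of the strands in the positions `p` and `p + 1`. -/
def crossing (p : ℕ) : StrandGroup L b n Y := ((crossMove L b).lower (n - (p + 2))).perm n Y

theorem realizes_crossing (w : List Λ) (x y : Λ) :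
    Realizes (crossing L b n Y w.length) (w := x :: y :: w) (w' := y :: x :: w)
      (crossIso (strands L b w) (L y) (L x)).hom :=
  (crossMove L b).realizes_perm (x :: y :: w)

end Braided
end Strands

/-! ### Naturality, hexagons and Yang–Baxter for crossings. -/

section Crossings
variable {A : Type u₁} [Category.{v₁} A] [MonoidalCategory A]
variable {M : Type u₂} [Category.{v₂} M] [MonoidalRightAction A M]

theorem actionHomLeft_assocIso_inv {m m' : M} (h : m ⟶ m') (X Y : A) :
    (h ⊵ᵣ X) ⊵ᵣ Y ≫ (αᵣ m' X Y).inv = (αᵣ m X Y).inv ≫ h ⊵ᵣ (X ⊗ Y) := by simp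

theorem actionHomLeft_assocIso_hom {m m' : M} (h : m ⟶ m') (X Y : A) :
    h ⊵ᵣ (X ⊗ Y) ≫ (αᵣ m' X Y).hom = (αᵣ m X Y).hom ≫ (h ⊵ᵣ X) ⊵ᵣ Y := by simp

theorem actionHomRight_assocIso_hom (m : M) {X X' Y Y' : A} (f : X ⟶ X') (g : Y ⟶ Y') :
    m ⊴ᵣ (f ⊗ₘ g) ≫ (αᵣ m X' Y').hom =
      (αᵣ m X Y).hom ≫ (m ⊴ᵣ f) ⊵ᵣ Y ≫ (m ⊙ᵣ X') ⊴ᵣ g := by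
  have := MonoidalRightAction.actionAssocIso_hom_naturality (𝟙 m) f g
  simpa only [MonoidalRightAction.id_actionHom, MonoidalRightAction.actionHom_def,
    MonoidalRightAction.id_actionHomLeft, Category.id_comp] using this

theorem pentagon_assocIso (m : M) (X Y Z : A) :
    m ⊴ᵣ (α_ X Y Z).inv ≫ (αᵣ m (X ⊗ Y) Z).hom ≫ (αᵣ m X Y).hom ⊵ᵣ Z =
      (αᵣ m X (Y ⊗ Z)).hom ≫ (αᵣ (m ⊙ᵣ X) Y Z).hom := by
  rw [← MonoidalRightAction.actionHom_associator, ← MonoidalRightAction.actionHomRight_comp_assoc]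
  simp only [Iso.inv_hom_id, MonoidalRightAction.actionHomRight_id, Category.id_comp]

theorem pentagon_assocIso' (m : M) (X Y Z : A) :
    m ⊴ᵣ (α_ X Y Z).inv ≫ (αᵣ m (X ⊗ Y) Z).hom =
      (αᵣ m X (Y ⊗ Z)).hom ≫ (αᵣ (m ⊙ᵣ X) Y Z).hom ≫ (αᵣ m X Y).inv ⊵ᵣ Z := by
  rw [← reassoc_of% pentagon_assocIso, MonoidalRightAction.hom_inv_actionHomLeft, Category.comp_id]

theorem pentagon_assocIso_inv (m : M) (X Y Z : A) :
    (αᵣ m (X ⊗ Y) Z).inv ≫ m ⊴ᵣ (α_ X Y Z).hom =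
      (αᵣ m X Y).hom ⊵ᵣ Z ≫ (αᵣ (m ⊙ᵣ X) Y Z).inv ≫ (αᵣ m X (Y ⊗ Z)).inv := by
  rw [Iso.inv_comp_eq, ← MonoidalRightAction.actionHom_associator_assoc]
  simp

variable [BraidedCategory A]

theorem crossIso_hom_naturality {m m' : M} (h : m ⟶ m') (X Y : A) :
    (h ⊵ᵣ X) ⊵ᵣ Y ≫ (crossIso m' X Y).hom = (crossIso m X Y).hom ≫ (h ⊵ᵣ Y) ⊵ᵣ X := by
  simp only [crossIso_hom, reassoc_of% actionHomLeft_assocIso_inv, Category.assoc,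
    ← actionHomLeft_assocIso_hom, MonoidalRightAction.action_exchange_assoc]

theorem crossIso_hom_naturality_left (m : M) {X X' : A} (f : X ⟶ X') (Y : A) :
    (m ⊴ᵣ f) ⊵ᵣ Y ≫ (crossIso m X' Y).hom = (crossIso m X Y).hom ≫ (m ⊙ᵣ Y) ⊴ᵣ f := by
  have h := actionHomRight_assocIso_hom m (𝟙 Y) f
  have h' := actionHomRight_assocIso_hom m f (𝟙 Y)
  simp only [MonoidalRightAction.actionHomRight_id, MonoidalRightAction.id_actionHomLeft,
    Category.id_comp, Category.comp_id, id_tensorHom, tensorHom_id] at h h'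
  simp only [crossIso_hom, Category.assoc, ← h]
  rw [Iso.eq_inv_comp, ← reassoc_of% h', Iso.hom_inv_id_assoc,
    ← MonoidalRightAction.actionHomRight_comp_assoc,
    ← MonoidalRightAction.actionHomRight_comp_assoc, BraidedCategory.braiding_naturality_left]

theorem crossIso_hom_naturality_right (m : M) (X : A) {Y Y' : A} (f : Y ⟶ Y') :
    (m ⊙ᵣ X) ⊴ᵣ f ≫ (crossIso m X Y').hom = (crossIso m X Y).hom ≫ (m ⊴ᵣ f) ⊵ᵣ X := by
  have h := actionHomRight_assocIso_hom m f (𝟙 X)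
  have h' := actionHomRight_assocIso_hom m (𝟙 X) f
  simp only [MonoidalRightAction.actionHomRight_id, MonoidalRightAction.id_actionHomLeft,
    Category.id_comp, Category.comp_id, id_tensorHom, tensorHom_id] at h h'
  simp only [crossIso_hom, Category.assoc, ← h]
  rw [Iso.eq_inv_comp, ← reassoc_of% h', Iso.hom_inv_id_assoc,
    ← MonoidalRightAction.actionHomRight_comp_assoc,
    ← MonoidalRightAction.actionHomRight_comp_assoc, BraidedCategory.braiding_naturality_right]

/-- A hexagon axiom, carried over to iterated actions by the module pentagon. -/
theorem crossIso_tensor_right (m : M) (X Y Z : A) :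
    (crossIso m X (Y ⊗ Z)).hom ≫ (αᵣ m Y Z).hom ⊵ᵣ X =
      (αᵣ (m ⊙ᵣ X) Y Z).hom ≫ (crossIso m X Y).hom ⊵ᵣ Z ≫ (crossIso (m ⊙ᵣ Y) X Z).hom := by
  simp [crossIso_hom, BraidedCategory.braiding_tensor_right_hom,
    reassoc_of% pentagon_assocIso', reassoc_of% pentagon_assocIso_inv]

theorem crossIso_tensor_left (m : M) (X Y Z : A) :
    (crossIso m (X ⊗ Y) Z).hom ≫ (αᵣ (m ⊙ᵣ Z) X Y).hom =
      (αᵣ m X Y).hom ⊵ᵣ Z ≫ (crossIso (m ⊙ᵣ X) Y Z).hom ≫ (crossIso m X Z).hom ⊵ᵣ Y := by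
  simp [crossIso_hom, BraidedCategory.braiding_tensor_left_hom,
    reassoc_of% pentagon_assocIso', reassoc_of% pentagon_assocIso_inv]

/-- Crossing `X` with `Y ⊗ Z` is natural with respect to the braiding of `Y` and `Z`; expanding both
sides by the hexagon gives the two sides. -/
theorem crossIso_yang_baxter (m : M) (X Y Z : A) :
    (crossIso m X Y).hom ⊵ᵣ Z ≫ (crossIso (m ⊙ᵣ Y) X Z).hom ≫ (crossIso m Y Z).hom ⊵ᵣ X =
      (crossIso (m ⊙ᵣ X) Y Z).hom ≫ (crossIso m X Z).hom ⊵ᵣ Y ≫ (crossIso (m ⊙ᵣ Z) X Y).hom := by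
  rw [← cancel_epi (αᵣ (m ⊙ᵣ X) Y Z).hom, ← reassoc_of% crossIso_tensor_right,
    crossIso_hom m Y Z]
  simp only [← MonoidalRightAction.comp_actionHomLeft, Iso.hom_inv_id_assoc]
  rw [MonoidalRightAction.comp_actionHomLeft, ← reassoc_of% crossIso_hom_naturality_right,
    crossIso_tensor_right, crossIso_hom (m ⊙ᵣ X) Y Z]
  simp

section Relations

variable {Λ : Type w} {L : Λ → A} {b : M} {n : ℕ} {Y : M}

theorem exists_realizes_crossing (p : ℕ) (w : List Λ) (hw : w.length = p + 2) :
    ∃ (w' : List Λ) (h : strands L b w ⟶ strands L b w'),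
      Realizes (crossing L b n Y p) h := by
  match w, hw with
  | x :: y :: w, hw =>
    obtain rfl : w.length = p := by simpa using hw
    exact ⟨_, _, realizes_crossing w x y⟩

/-- A crossing commutes with everything that happens on the strands before it. -/
theorem commute_crossing {g : StrandGroup L b n Y} {p : ℕ} (hp : p + 2 ≤ n)
    (H : ∀ w : List Λ, w.length = p →
      ∃ (w' : List Λ) (h : strands L b w ⟶ strands L b w'), Realizes g h) :
    Commute g (crossing L b n Y p) := by
  refine StrandGroup.ext_of_realizes (p + 2) hp fun w hw => ?_
  match w, hw with
  | x :: y :: w, hw =>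
    obtain rfl : w.length = p := by simpa using hw
    obtain ⟨w', h, r⟩ := H w rfl
    -- The index of the crossing is the number of strands below it, which `g` preserves.
    exact ⟨_, _, ((r.whiskerRight y).whiskerRight x).mul (r.1 ▸ realizes_crossing w' x y),
      ((realizes_crossing w x y).mul ((r.whiskerRight x).whiskerRight y)).of_eq
        (crossIso_hom_naturality h (L y) (L x)).symm⟩

/-- The crossing at `p` takes place within the first `q` strands. -/
theorem commute_crossing_crossing {p q : ℕ} (hpq : p + 1 < q) (hq : q + 2 ≤ n) :
    Commute (crossing L b n Y p) (crossing L b n Y q) :=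
  commute_crossing hq fun w hw =>
    exists_realizes_of_le (exists_realizes_crossing p) w (by lia)

theorem crossing_braid {p : ℕ} (hp : p + 3 ≤ n) :
    crossing L b n Y p * crossing L b n Y (p + 1) * crossing L b n Y p =
      crossing L b n Y (p + 1) * crossing L b n Y p * crossing L b n Y (p + 1) := by
  refine StrandGroup.ext_of_realizes (p + 3) hp fun w hw => ?_
  match w, hw with
  | x :: y :: z :: w, hw =>
    obtain rfl : w.length = p := by simpa using hw
    refine ⟨_, _, (((realizes_crossing w y z).whiskerRight x).mul
      (realizes_crossing (y :: w) x z)).mul ((realizes_crossing w x y).whiskerRight z), ?_⟩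
    have e := crossIso_yang_baxter (strands L b w) (L z) (L y) (L x)
    rw [← Category.assoc, ← Category.assoc] at e
    exact (((realizes_crossing (z :: w) x y).mul
      ((realizes_crossing w x z).whiskerRight y)).mul (realizes_crossing (x :: w) y z)).of_eq e.symm

end Relations

end Crossings

/-! ### Normal forms of words -/

section Gluing

variable {A : Type u₁} [Category.{v₁} A] [MonoidalCategory A]
variable {M : Type u₂} [Category.{v₂} M] [MonoidalRightAction A M]

/-- Change the acting object along an isomorphism. -/
@[simps]
def actPre {m m' : M} {X Y : A} (f : X ≅ Y) (s : m ⊙ᵣ Y ≅ m') : m ⊙ᵣ X ≅ m' where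
  hom := m ⊴ᵣ f.hom ≫ s.hom
  inv := s.inv ≫ m ⊴ᵣ f.inv

/-- Let the factors of a tensor product act one after the other. -/
@[simps]
def actGlue {m m' m'' : M} {X Y : A} (s : m ⊙ᵣ X ≅ m') (t : m' ⊙ᵣ Y ≅ m'') :
    m ⊙ᵣ (X ⊗ Y) ≅ m'' where
  hom := (αᵣ m X Y).hom ≫ s.hom ⊵ᵣ Y ≫ t.hom
  inv := t.inv ≫ s.inv ⊵ᵣ Y ≫ (αᵣ m X Y).inv

/-- Conjugate a morphism before the action. -/
@[simps]
def actConj {m m' n n' : M} {X : A} (s : m ⊙ᵣ X ≅ n) (h : m ≅ m') (s' : m' ⊙ᵣ X ≅ n') : n ≅ n' where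
  hom := s.inv ≫ h.hom ⊵ᵣ X ≫ s'.hom
  inv := s'.inv ≫ h.inv ⊵ᵣ X ≫ s.hom

variable {m m' m'' m''' : M} {X Y Z : A}

theorem actPre_refl (s : m ⊙ᵣ X ≅ m') : actPre (Iso.refl X) s = s := by
  ext; simp

theorem actPre_actPre (f : X ≅ Y) (g : Y ≅ Z) (s : m ⊙ᵣ Z ≅ m') :
    actPre f (actPre g s) = actPre (f ≪≫ g) s := by
  ext; simp

theorem actGlue_actPre_left (f : X ≅ Z) (s : m ⊙ᵣ Z ≅ m') (t : m' ⊙ᵣ Y ≅ m'') :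
    actGlue (actPre f s) t = actPre (whiskerRightIso f Y) (actGlue s t) := by
  ext; simp

theorem actGlue_actPre_right (s : m ⊙ᵣ X ≅ m') (f : Y ≅ Z) (t : m' ⊙ᵣ Z ≅ m'') :
    actGlue s (actPre f t) = actPre (whiskerLeftIso X f) (actGlue s t) := by
  ext
  simp only [actGlue_hom, actPre_hom, whiskerLeftIso_hom,
    ← MonoidalRightAction.action_exchange_assoc, MonoidalRightAction.action_actionHomRight,
    Category.assoc, Iso.hom_inv_id_assoc]

/-- The pentagon of the module category; it makes `α` an identity between strands. -/
theorem actGlue_assoc (s : m ⊙ᵣ X ≅ m') (t : m' ⊙ᵣ Y ≅ m'') (u : m'' ⊙ᵣ Z ≅ m''') :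
    actGlue (actGlue s t) u = actPre (α_ X Y Z) (actGlue s (actGlue t u)) := by
  ext; simp

theorem actGlue_unit_left (s : m ⊙ᵣ X ≅ m') : actGlue (ρᵣ m) s = actPre (λ_ X) s := by
  ext; simp

theorem actGlue_unit_right (s : m ⊙ᵣ X ≅ m') : actGlue s (ρᵣ m') = actPre (ρ_ X) s := by
  ext; simp

theorem symm_trans_actPre_trans {n n' n'' : M} (s : m ⊙ᵣ X ≅ n) (f : X ≅ Y) (t : m ⊙ᵣ Y ≅ n')
    (g : Y ≅ Z) (u : m ⊙ᵣ Z ≅ n'') :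
    s.symm ≪≫ actPre (f ≪≫ g) u = (s.symm ≪≫ actPre f t) ≪≫ (t.symm ≪≫ actPre g u) := by
  ext; simp

theorem symm_trans_actPre_symm {n n' : M} (s : m ⊙ᵣ X ≅ n) (f : X ≅ Y) (t : m ⊙ᵣ Y ≅ n') :
    (s.symm ≪≫ actPre f t).symm = t.symm ≪≫ actPre f.symm s := by
  ext; simp

/-- The conjugate of a tensor product of isomorphisms, in terms of the conjugates of the
factors. -/
theorem actGlue_symm_trans_actPre_tensor {n₁ n₁' n₂ n₂' n₃ : M} {X' Y' : A}
    (s : m ⊙ᵣ X ≅ n₁) (t : n₁ ⊙ᵣ Y ≅ n₂) (f : X ≅ X') (g : Y ≅ Y')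
    (s' : m ⊙ᵣ X' ≅ n₁') (t' : n₁' ⊙ᵣ Y' ≅ n₃) (t'' : n₁' ⊙ᵣ Y ≅ n₂') :
    (actGlue s t).symm ≪≫ actPre (f ⊗ᵢ g) (actGlue s' t') =
      actConj t (s.symm ≪≫ actPre f s') t'' ≪≫ (t''.symm ≪≫ actPre g t') := by
  ext
  simp only [Iso.trans_hom, Iso.symm_hom, actGlue_hom, actGlue_inv, actPre_hom, tensorIso_hom,
    actConj_hom, MonoidalRightAction.comp_actionHomLeft, Category.assoc,
    reassoc_of% actionHomRight_assocIso_hom, Iso.inv_hom_id_assoc,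
    MonoidalRightAction.action_exchange_assoc, Iso.hom_inv_id_assoc]

/-- The exchange law: `f` changes the acting object and `h` the object acted on, so `f` cancels. -/
theorem actConj_actPre {n n' : M} (f : X ≅ Y) (s : m ⊙ᵣ Y ≅ n) (h : m ≅ m') (s' : m' ⊙ᵣ Y ≅ n') :
    actConj (actPre f s) h (actPre f s') = actConj s h s' := by
  ext
  simp [← MonoidalRightAction.action_exchange_assoc]

theorem actConj_actGlue {n n' l l' : M} (s : m ⊙ᵣ X ≅ n) (t : n ⊙ᵣ Y ≅ l) (h : m ≅ m')
    (s' : m' ⊙ᵣ X ≅ n') (t' : n' ⊙ᵣ Y ≅ l') :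
    actConj (actGlue s t) h (actGlue s' t') = actConj t (actConj s h s') t' := by
  ext; simp

theorem actPre_symm_trans_actPre {n n' : M} {X' Y' : A} (f : X ≅ X') (s : m ⊙ᵣ X' ≅ n) (g : X ≅ Y)
    (f' : Y ≅ Y') (t : m ⊙ᵣ Y' ≅ n') :
    (actPre f s).symm ≪≫ actPre g (actPre f' t) = s.symm ≪≫ actPre (f.symm ≪≫ g ≪≫ f') t := by
  ext; simp

section Braided

variable [BraidedCategory A]

/-- The crossing of two objects, up to identifications of the actions with given objects. -/
def actSwap {n₁ n₂ n₁' n₂' : M} (s : m ⊙ᵣ X ≅ n₁) (t : n₁ ⊙ᵣ Y ≅ n₂) (t' : m ⊙ᵣ Y ≅ n₁')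
    (s' : n₁' ⊙ᵣ X ≅ n₂') : n₂ ≅ n₂' :=
  (actGlue s t).symm ≪≫ actPre (β_ X Y) (actGlue t' s')

theorem actSwap_hom {n₁ n₂ n₁' n₂' : M} (s : m ⊙ᵣ X ≅ n₁) (t : n₁ ⊙ᵣ Y ≅ n₂) (t' : m ⊙ᵣ Y ≅ n₁')
    (s' : n₁' ⊙ᵣ X ≅ n₂') :
    (actSwap s t t' s').hom =
      t.inv ≫ s.inv ⊵ᵣ Y ≫ (crossIso m X Y).hom ≫ t'.hom ⊵ᵣ X ≫ s'.hom := by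
  simp [actSwap, crossIso_hom]

theorem actSwap_refl (m : M) (X Y : A) :
    actSwap (Iso.refl (m ⊙ᵣ X)) (Iso.refl _) (Iso.refl (m ⊙ᵣ Y)) (Iso.refl _) =
      crossIso m X Y := by
  ext; simp [actSwap_hom]

theorem actSwap_actPre_left {n₁ n₂ n₁' n₂' : M} (f : X ≅ Z) (s : m ⊙ᵣ Z ≅ n₁) (t : n₁ ⊙ᵣ Y ≅ n₂)
    (t' : m ⊙ᵣ Y ≅ n₁') (s' : n₁' ⊙ᵣ Z ≅ n₂') :
    actSwap (actPre f s) t t' (actPre f s') = actSwap s t t' s' := by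
  ext
  simp only [actSwap_hom, actPre_inv, actPre_hom, MonoidalRightAction.comp_actionHomLeft,
    Category.assoc, ← MonoidalRightAction.action_exchange_assoc,
    ← reassoc_of% crossIso_hom_naturality_left]
  simp only [← MonoidalRightAction.comp_actionHomLeft_assoc,
    MonoidalRightAction.actionHomRight_inv_hom, Category.comp_id]

theorem actSwap_actPre_right {n₁ n₂ n₁' n₂' : M} (f : Y ≅ Z) (s : m ⊙ᵣ X ≅ n₁) (t : n₁ ⊙ᵣ Z ≅ n₂)
    (t' : m ⊙ᵣ Z ≅ n₁') (s' : n₁' ⊙ᵣ X ≅ n₂') :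
    actSwap s (actPre f t) (actPre f t') s' = actSwap s t t' s' := by
  ext
  simp only [actSwap_hom, actPre_inv, actPre_hom, MonoidalRightAction.comp_actionHomLeft,
    Category.assoc, MonoidalRightAction.action_exchange_assoc,
    ← reassoc_of% crossIso_hom_naturality_right,
    MonoidalRightAction.actionHomRight_inv_hom_assoc]

/-- Braiding with the unit is a composite of unitors, in accordance with a unit having no strands.
-/
theorem actSwap_unit_left {n₁ : M} (t : m ⊙ᵣ Y ≅ n₁) :
    actSwap (ρᵣ m) t t (ρᵣ n₁) = Iso.refl n₁ := by
  rw [actSwap, actGlue_unit_left, actGlue_unit_right, actPre_symm_trans_actPre,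
    show (λ_ Y).symm ≪≫ β_ (𝟙_ A) Y ≪≫ ρ_ Y = Iso.refl Y by ext; simp, actPre_refl,
    Iso.symm_self_id]

theorem actSwap_unit_right {n₁ : M} (s : m ⊙ᵣ X ≅ n₁) :
    actSwap s (ρᵣ n₁) (ρᵣ m) s = Iso.refl n₁ := by
  rw [actSwap, actGlue_unit_left, actGlue_unit_right, actPre_symm_trans_actPre,
    show (ρ_ X).symm ≪≫ β_ X (𝟙_ A) ≪≫ λ_ X = Iso.refl X by ext; simp, actPre_refl,
    Iso.symm_self_id]

/-- The hexagon for normal forms: `X` crosses `Y` below `Z`, then crosses `Z`. The intermediate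
identifications `s''` and `t₂''` are arbitrary, since they cancel. -/
theorem actSwap_actGlue_right {n₁ n₂ k₁ l₁ l₂ n₃ n₁' n₂' : M} (s : m ⊙ᵣ X ≅ n₁)
    (t₁ : n₁ ⊙ᵣ Y ≅ k₁) (t₂ : k₁ ⊙ᵣ Z ≅ n₂) (t₁' : m ⊙ᵣ Y ≅ l₁) (t₂' : l₁ ⊙ᵣ Z ≅ n₁')
    (s' : n₁' ⊙ᵣ X ≅ n₂') (s'' : l₁ ⊙ᵣ X ≅ l₂) (t₂'' : l₂ ⊙ᵣ Z ≅ n₃) :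
    actSwap s (actGlue t₁ t₂) (actGlue t₁' t₂') s' =
      actConj t₂ (actSwap s t₁ t₁' s'') t₂'' ≪≫ actSwap s'' t₂'' t₂' s' := by
  ext
  simp only [actSwap_hom, actGlue_inv, actGlue_hom, actConj_hom, Iso.trans_hom,
    MonoidalRightAction.comp_actionHomLeft, Category.assoc, Iso.hom_inv_id_assoc,
    reassoc_of% crossIso_tensor_right, reassoc_of% crossIso_hom_naturality,
    ← reassoc_of% actionHomLeft_assocIso_inv, Iso.inv_hom_id_assoc,
    MonoidalRightAction.hom_inv_actionHomLeft_assoc]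

theorem actSwap_actGlue_left {n₂ k₁ k₂ l₁ l₂ n₁' n₂' k₃ : M} (s₁ : m ⊙ᵣ X ≅ k₁)
    (s₂ : k₁ ⊙ᵣ Y ≅ k₂) (t : k₂ ⊙ᵣ Z ≅ n₂) (t' : m ⊙ᵣ Z ≅ n₁') (s₁' : n₁' ⊙ᵣ X ≅ k₃)
    (s₂' : k₃ ⊙ᵣ Y ≅ n₂') (t'' : k₁ ⊙ᵣ Z ≅ l₁) (s₂'' : l₁ ⊙ᵣ Y ≅ l₂) :
    actSwap (actGlue s₁ s₂) t t' (actGlue s₁' s₂') =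
      actSwap s₂ t t'' s₂'' ≪≫ actConj s₂'' (actSwap s₁ t'' t' s₁') s₂' := by
  ext
  simp only [actSwap_hom, actGlue_inv, actGlue_hom, actConj_hom, Iso.trans_hom,
    MonoidalRightAction.comp_actionHomLeft, Category.assoc, Iso.hom_inv_id_assoc,
    reassoc_of% actionHomLeft_assocIso_hom, reassoc_of% crossIso_tensor_left,
    MonoidalRightAction.hom_inv_actionHomLeft_assoc,
    MonoidalRightAction.inv_hom_actionHomLeft_assoc, reassoc_of% crossIso_hom_naturality]

end Braided

end Gluing

/-! ### Signed strands of a word and its normal form. -/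

section NormalForm

variable {A : Type u₁} [Category.{v₁} A] [MonoidalCategory A]
variable {M : Type u₂} [Category.{v₂} M] [MonoidalRightAction A M]
variable {ι : Type w}

namespace TensorWord

/-- The value of `S`, or of `phi S` if the sign is `true`. -/
def obj (P : AntiInvolution A) (X : ι → A) : Bool → TensorWord ι → A
  | false, S => (S.functor P).obj X
  | true, S => P.Φ.obj ((S.functor P).obj X)

/-- The object that a variable with a sign denotes. -/
def letter (P : AntiInvolution A) (X : ι → A) (x : ι × Bool) : A := obj P X x.2 (.var x.1)

/-- Apply `Φ` to an isomorphism if the sign is `true`. -/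
def mapObj (P : AntiInvolution A) (X : ι → A) {S T : TensorWord ι} : (ε : Bool) →
    ((S.functor P).obj X ≅ (T.functor P).obj X) → (obj P X ε S ≅ obj P X ε T)
  | false, f => f
  | true, f => P.Φ.mapIso f

/-- The strands of `S`, or of `phi S` if the sign is `true`, following the strands `w`. -/
def letters : TensorWord ι → Bool → List (ι × Bool) → List (ι × Bool)
  | var i, ε, w => (i, ε) :: w
  | unit, _, w => w
  | tensor S T, false, w => T.letters false (S.letters false w)
  | tensor S T, true, w => S.letters true (T.letters true w)
  | phi S, ε, w => S.letters (!ε) w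

theorem length_letters (S : TensorWord ι) (ε : Bool) (w : List (ι × Bool)) :
    (S.letters ε w).length = w.length + S.length := by
  induction S generalizing ε w with
  | var i => rfl
  | unit => rfl
  | tensor S T hS hT =>
    cases ε
    · rw [letters, hT, hS, length, Nat.add_assoc]
    · rw [letters, hS, hT, length]; lia
  | phi S hS => exact hS _ w

variable (P : AntiInvolution A) (X : ι → A) (b : M)

/-- The action of a word is the successive action of its strands. -/
def toStrands : (S : TensorWord ι) → (ε : Bool) → (w : List (ι × Bool)) →
    (strands (letter P X) b w ⊙ᵣ obj P X ε S ≅ strands (letter P X) b (S.letters ε w))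
  | var _, _, _ => Iso.refl _
  | unit, false, _ => ρᵣ _
  | unit, true, _ => actPre P.Φ₀ (ρᵣ _)
  | tensor S T, false, w => actGlue (S.toStrands false w) (T.toStrands false _)
  | tensor S T, true, w =>
    actPre (P.Φ₂ _ _).symm (actGlue (T.toStrands true w) (S.toStrands true _))
  | phi S, false, w => S.toStrands true w
  | phi S, true, w => actPre (P.t.app _) (S.toStrands false w)

/-- The isomorphism between objects of strands that corresponds to an isomorphism of words. -/
def strandIso {S T : TensorWord ι} {ε δ : Bool} (w : List (ι × Bool))
    (f : obj P X ε S ≅ obj P X δ T) :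
    strands (letter P X) b (S.letters ε w) ≅ strands (letter P X) b (T.letters δ w) :=
  (S.toStrands P X b ε w).symm ≪≫ actPre f (T.toStrands P X b δ w)

end TensorWord
open TensorWord

variable {P : AntiInvolution A} {X : ι → A} {b : M} {n : ℕ} {Y : M}

/-- Letting a further word act afterwards does not change the group element, since its normal form
only appends letters and `Realizes` already allows for these. -/
theorem Realizes.actConj_toStrands {g : StrandGroup (letter P X) b n Y} {w w' : List (ι × Bool)}
    {h : strands (letter P X) b w ≅ strands (letter P X) b w'} (H : Realizes g h.hom)
    (S : TensorWord ι) (ε : Bool) :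
    Realizes g (actConj (S.toStrands P X b ε w) h (S.toStrands P X b ε w')).hom := by
  induction S generalizing ε w w' with
  | var i =>
    exact (H.whiskerRight (i, ε)).of_eq
      ((Category.id_comp _).trans (Category.comp_id _)).symm
  | unit =>
    have key : ∀ ε, (actConj (toStrands P X b .unit ε w) h (toStrands P X b .unit ε w')) = h := by
      have : actConj (ρᵣ[A] _) h (ρᵣ[A] _) = h := by
        ext; simp
      rintro (_ | _)
      · exact this
      · exact (actConj_actPre P.Φ₀ _ h _).trans this
    exact H.of_eq (congrArg Iso.hom (key ε)).symm
  | tensor S T hS hT =>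
    cases ε
    · exact (hT (hS H false) false).of_eq (congrArg Iso.hom (actConj_actGlue _ _ _ _ _)).symm
    · exact (hS (hT H true) true).of_eq (congrArg Iso.hom
        ((actConj_actPre _ _ _ _).trans (actConj_actGlue _ _ _ _ _))).symm
  | phi S hS =>
    cases ε
    · exact hS H true
    · exact (hS H false).of_eq (congrArg Iso.hom (actConj_actPre _ _ _ _)).symm

end NormalForm

/-! ### The axioms of the anti-involution as identities of normal forms. -/

section AntiInvolution

variable {A : Type u₁} [Category.{v₁} A] [MonoidalCategory A]
variable {M : Type u₂} [Category.{v₂} M] [MonoidalRightAction A M]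
variable (P : AntiInvolution A) {m n₁ n₂ n₃ : M} {X Y Z : A}

/-- Let the factors of a tensor product under `Φ` act one after the other. -/
def AntiInvolution.actGlue (t : m ⊙ᵣ P.Φ.obj Y ≅ n₁) (s : n₁ ⊙ᵣ P.Φ.obj X ≅ n₂) :
    m ⊙ᵣ P.Φ.obj (X ⊗ Y) ≅ n₂ :=
  actPre (P.Φ₂ X Y).symm (_root_.actGlue t s)

theorem AntiInvolution.actGlue_assoc (u : m ⊙ᵣ P.Φ.obj Z ≅ n₁) (t : n₁ ⊙ᵣ P.Φ.obj Y ≅ n₂)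
    (s : n₂ ⊙ᵣ P.Φ.obj X ≅ n₃) :
    P.actGlue u (P.actGlue t s) =
      actPre (P.Φ.mapIso (α_ X Y Z)) (P.actGlue (P.actGlue u t) s) := by
  simp only [AntiInvolution.actGlue, actGlue_actPre_right, actGlue_actPre_left, actPre_actPre,
    _root_.actGlue_assoc]
  congr 1
  ext
  have := P.Φ₂_assoc X Y Z
  simp only [Iso.trans_hom, Iso.symm_hom, whiskerLeftIso_hom, whiskerRightIso_hom,
    Functor.mapIso_hom]
  rw [← cancel_epi (P.Φ₂ (X ⊗ Y) Z).hom, ← cancel_epi (P.Φ.obj Z ◁ (P.Φ₂ X Y).hom),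
    reassoc_of% this]
  simp

theorem AntiInvolution.actGlue_unit_left (t : m ⊙ᵣ P.Φ.obj X ≅ n₁) :
    P.actGlue t (actPre P.Φ₀ (ρᵣ n₁)) = actPre (P.Φ.mapIso (λ_ X)) t := by
  simp only [AntiInvolution.actGlue, actGlue_actPre_right, actPre_actPre,
    _root_.actGlue_unit_right]
  congr 1
  ext
  have := P.Φ₂_unit_left X
  simp only [Iso.trans_hom, Iso.symm_hom, whiskerLeftIso_hom, Functor.mapIso_hom]
  rw [Iso.inv_comp_eq, this]

theorem AntiInvolution.actGlue_unit_right (s : m ⊙ᵣ P.Φ.obj X ≅ n₁) :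
    P.actGlue (actPre P.Φ₀ (ρᵣ m)) s = actPre (P.Φ.mapIso (ρ_ X)) s := by
  simp only [AntiInvolution.actGlue, actGlue_actPre_left, actPre_actPre,
    _root_.actGlue_unit_left]
  congr 1
  ext
  have := P.Φ₂_unit_right X
  simp only [Iso.trans_hom, Iso.symm_hom, whiskerRightIso_hom, Functor.mapIso_hom]
  rw [Iso.inv_comp_eq, this]

/-- Both ways of letting the factors of `Φ (Φ X ⊗ Φ Y)` act agree. -/
theorem AntiInvolution.actGlue_actPre_t (s : m ⊙ᵣ X ≅ n₁) (t : n₁ ⊙ᵣ Y ≅ n₂) :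
    P.actGlue (actPre (P.t.app X) s) (actPre (P.t.app Y) t) =
      actPre (P.Φ.mapIso (P.Φ₂ X Y)) (actPre (P.t.app (X ⊗ Y)) (_root_.actGlue s t)) := by
  simp only [AntiInvolution.actGlue, actGlue_actPre_left, actGlue_actPre_right, actPre_actPre]
  congr 1
  ext
  have := P.t_tensor X Y
  simp only [Iso.trans_hom, Iso.symm_hom, whiskerRightIso_hom, Functor.mapIso_hom,
    whiskerLeftIso_hom]
  rw [Iso.inv_comp_eq, Iso.app_hom, Iso.app_hom, Iso.app_hom, this]
  exact (MonoidalCategory.tensorHom_def' (P.t.hom.app X) (P.t.hom.app Y)).symm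

theorem AntiInvolution.actPre_t_unit :
    actPre (P.t.app (𝟙_ A)) (ρᵣ m) = actPre (P.Φ.mapIso P.Φ₀) (actPre P.Φ₀ (ρᵣ m)) := by
  rw [actPre_actPre]
  congr 1
  ext
  exact P.t_unit.symm

/-- By `map_t`, the two ways of removing a pair of applications from `Φ³` agree. -/
theorem AntiInvolution.actPre_t_obj (s : m ⊙ᵣ P.Φ.obj X ≅ n₁) :
    actPre (P.t.app (P.Φ.obj X)) s = actPre (P.Φ.mapIso (P.t.app X)) s := by
  congr 1
  ext
  exact (P.map_t X).symm

variable {n₁' n₂' k : M} {X' Y' : A}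

theorem AntiInvolution.actGlue_symm_trans_actPre_tensor (t : m ⊙ᵣ P.Φ.obj Y ≅ n₁)
    (s : n₁ ⊙ᵣ P.Φ.obj X ≅ n₂) (f : X ≅ X') (g : Y ≅ Y') (t' : m ⊙ᵣ P.Φ.obj Y' ≅ n₁')
    (s' : n₁' ⊙ᵣ P.Φ.obj X' ≅ n₃) (s'' : n₁ ⊙ᵣ P.Φ.obj X' ≅ n₂') :
    (P.actGlue t s).symm ≪≫ actPre (P.Φ.mapIso (f ⊗ᵢ g)) (P.actGlue t' s') =
      (s.symm ≪≫ actPre (P.Φ.mapIso f) s'') ≪≫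
        actConj s'' (t.symm ≪≫ actPre (P.Φ.mapIso g) t') s' := by
  have e : (P.Φ₂ X Y) ≪≫ P.Φ.mapIso (f ⊗ᵢ g) ≪≫ (P.Φ₂ X' Y').symm =
      P.Φ.mapIso g ⊗ᵢ P.Φ.mapIso f := by
    ext
    have := P.Φ₂_natural f.hom g.hom
    simp only [Iso.trans_hom, Iso.symm_hom, Functor.mapIso_hom, tensorIso_hom]
    rw [← reassoc_of% this, Iso.hom_inv_id, Category.comp_id]
  rw [AntiInvolution.actGlue, AntiInvolution.actGlue, actPre_symm_trans_actPre, Iso.symm_symm_eq, e]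
  ext
  simp [MonoidalCategory.tensorHom_def', MonoidalRightAction.action_exchange_assoc]

/-- As `Φ` is braided, the image of a positive crossing is again a positive crossing, with the block
of `Y` now in front. -/
theorem AntiInvolution.actGlue_symm_trans_actPre_braiding [BraidedCategory A]
    (hP : (P.Φ₂ X Y).hom ≫ P.Φ.map (β_ X Y).hom =
      (β_ (P.Φ.obj Y) (P.Φ.obj X)).hom ≫ (P.Φ₂ Y X).hom)
    (t : m ⊙ᵣ P.Φ.obj Y ≅ n₁) (s : n₁ ⊙ᵣ P.Φ.obj X ≅ n₂) (s' : m ⊙ᵣ P.Φ.obj X ≅ n₁')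
    (t' : n₁' ⊙ᵣ P.Φ.obj Y ≅ n₂') :
    (P.actGlue t s).symm ≪≫ actPre (P.Φ.mapIso (β_ X Y)) (P.actGlue s' t') =
      actSwap t s s' t' := by
  rw [AntiInvolution.actGlue, AntiInvolution.actGlue, actPre_symm_trans_actPre, actSwap,
    Iso.symm_symm_eq]
  congr 2
  ext
  simp only [Iso.trans_hom, Iso.symm_hom, Functor.mapIso_hom]
  rw [reassoc_of% hP, Iso.hom_inv_id, Category.comp_id]

end AntiInvolution

/-! ### Structural isomorphisms in `A` realize their braids. -/

section StructuralIsos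

open TensorWord

variable {A : Type u₁} [Category.{v₁} A] [MonoidalCategory A]
variable {M : Type u₂} [Category.{v₂} M] [MonoidalRightAction A M]
variable {ι : Type w}
variable {P : AntiInvolution A} {X : ι → A} {b : M} {n : ℕ} {Y : M}

/-- For generators with trivial braid it suffices that the normal forms of source and target
correspond. -/
theorem realizes_one_of_eq_actPre {w l : List (ι × Bool)} {U V : A}
    (s : strands (letter P X) b w ⊙ᵣ U ≅ strands (letter P X) b l) (f : U ≅ V)
    (t : strands (letter P X) b w ⊙ᵣ V ≅ strands (letter P X) b l) (h : s = actPre f t) :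
    Realizes (1 : StrandGroup (letter P X) b n Y) (s.symm ≪≫ actPre f t).hom := by
  rw [h, Iso.symm_self_id]
  exact .one _

theorem StructuralIso.length_eq {S T : TensorWord ι} (f : StructuralIso S T) :
    S.length = T.length := by
  induction f with
  | id => rfl
  | comp _ _ hf hg => exact hf.trans hg
  | inv _ hf => exact hf.symm
  | tensor _ _ hf hg => exact congrArg₂ (· + ·) hf hg
  | phi _ hf => exact hf
  | α => exact Nat.add_assoc _ _ _
  | lam => exact Nat.zero_add _
  | rho => rfl
  | Φ₂ => exact Nat.add_comm _ _
  | Φ₀ => rfl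
  | t => rfl
  | σ => exact Nat.add_comm _ _

variable [BraidedCategory A]

/-- The case of one letter `y` passing a word: each tensor product in `S` is split by a hexagon. The
other hexagon then splits the second word in `realizes_blockBraid`. -/
theorem realizes_strandBraid {G : Type} [Group G] (φ : G →* StrandGroup (letter P X) b n Y)
    (s : ℕ → G) (S : TensorWord ι) (ε : Bool) (w : List (ι × Bool)) (y : ι × Bool)
    (hs : ∀ i < S.length, φ (s i) = crossing (letter P X) b n Y (w.length + i)) :
    Realizes (φ (strandBraid s S.length))
      (actSwap (S.toStrands P X b ε w) ((TensorWord.var y.1).toStrands P X b y.2 _)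
        ((TensorWord.var y.1).toStrands P X b y.2 w) (S.toStrands P X b ε (y :: w))).hom := by
  induction S generalizing ε w s with
  | var i =>
    have h := realizes_crossing (L := letter P X) (b := b) (n := n) (Y := Y) w y (i, ε)
    simp only [TensorWord.length, strandBraid, mul_one]
    rw [hs 0 Nat.zero_lt_one]
    exact h.of_eq (congrArg Iso.hom (actSwap_refl _ _ _)).symm
  | unit =>
    simp only [TensorWord.length, strandBraid, map_one]
    cases ε
    · exact (Realizes.one _).of_eq (congrArg Iso.hom (actSwap_unit_left _)).symm
    · exact (Realizes.one _).of_eq (congrArg Iso.hom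
        ((actSwap_actPre_left _ _ _ _ _).trans (actSwap_unit_left _))).symm
  | tensor S T hS hT =>
    have e := hs
    simp only [TensorWord.length] at e ⊢
    cases ε
    · rw [strandBraid_add, map_mul]
      have h₁ := hS s false w (fun i hi => e i (by lia))
      have h₂ := hT (fun i => s (S.length + i)) false (S.letters false w) fun i hi => by
        rw [e _ (by lia), length_letters, Nat.add_assoc]
      exact (h₂.mul (h₁.actConj_toStrands T false)).of_eq
        (congrArg Iso.hom (actSwap_actGlue_left _ _ _ _ _ _ _ _)).symm
    -- Under `Φ` the strands of `T` precede those of `S`.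
    · rw [Nat.add_comm, strandBraid_add, map_mul]
      have h₁ := hT s true w (fun i hi => e i (by lia))
      have h₂ := hS (fun i => s (T.length + i)) true (T.letters true w) fun i hi => by
        rw [e _ (by lia), length_letters, Nat.add_assoc]
      exact (h₂.mul (h₁.actConj_toStrands S true)).of_eq (congrArg Iso.hom
        ((actSwap_actPre_left _ _ _ _ _).trans (actSwap_actGlue_left _ _ _ _ _ _ _ _))).symm
  | phi S hS =>
    cases ε
    · exact hS s true w hs
    · exact (hS s false w hs).of_eq (congrArg Iso.hom (actSwap_actPre_left _ _ _ _ _)).symm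

theorem realizes_blockBraid {G : Type} [Group G] (φ : G →* StrandGroup (letter P X) b n Y)
    (s : ℕ → G) (S T : TensorWord ι) (ε δ : Bool) (w : List (ι × Bool))
    (hs : ∀ i, i + 1 < S.length + T.length →
      φ (s i) = crossing (letter P X) b n Y (w.length + i)) :
    Realizes (φ (blockBraid s S.length T.length))
      (actSwap (S.toStrands P X b ε w) (T.toStrands P X b δ _)
        (T.toStrands P X b δ w) (S.toStrands P X b ε _)).hom := by
  induction T generalizing δ w s with
  | var j =>
    simp only [TensorWord.length, blockBraid_one]
    exact realizes_strandBraid φ s S ε w (j, δ) fun i hi => hs i (Nat.succ_lt_succ hi)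
  | unit =>
    simp only [TensorWord.length, blockBraid, map_one]
    cases δ
    · exact (Realizes.one _).of_eq (congrArg Iso.hom (actSwap_unit_right _)).symm
    · exact (Realizes.one _).of_eq (congrArg Iso.hom
        ((actSwap_actPre_right _ _ _ _ _).trans (actSwap_unit_right _))).symm
  | tensor T U hT hU =>
    have e := hs
    simp only [TensorWord.length] at e ⊢
    cases δ
    · rw [blockBraid_add_right, map_mul]
      have h₁ := hT s false w (fun i hi => e i (by lia))
      have h₂ := hU (fun i => s (T.length + i)) false (T.letters false w) fun i hi => by
        rw [e _ (by lia), length_letters, Nat.add_assoc]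
      exact ((h₁.actConj_toStrands U false).mul h₂).of_eq
        (congrArg Iso.hom (actSwap_actGlue_right _ _ _ _ _ _ _ _)).symm
    · rw [Nat.add_comm, blockBraid_add_right, map_mul]
      have h₁ := hU s true w (fun i hi => e i (by lia))
      have h₂ := hT (fun i => s (U.length + i)) true (U.letters true w) fun i hi => by
        rw [e _ (by lia), length_letters, Nat.add_assoc]
      exact ((h₁.actConj_toStrands T true).mul h₂).of_eq (congrArg Iso.hom
        ((actSwap_actPre_right _ _ _ _ _).trans (actSwap_actGlue_right _ _ _ _ _ _ _ _))).symm
  | phi T hT =>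
    cases δ
    · exact hT s true w hs
    · exact (hT s false w hs).of_eq (congrArg Iso.hom (actSwap_actPre_right _ _ _ _ _)).symm

/-- The position, among the strands of a word with a sign, of the crossing in position `i` of the
word. -/
def crossingIndex (ε : Bool) (l i : ℕ) : ℕ := if ε then l - 2 - i else i

/-- The sign and the preceding strands `w` are general because `phi` flips the former and `tensor`
extends the latter. For sign `true` the positions in the word are reversed, as `hs` records. -/
theorem StructuralIso.realizes
    (hP : ∀ X Y : A, (P.Φ₂ X Y).hom ≫ P.Φ.map (β_ X Y).hom =
      (β_ (P.Φ.obj Y) (P.Φ.obj X)).hom ≫ (P.Φ₂ Y X).hom)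
    {G : Type} [Group G] (φ : G →* StrandGroup (letter P X) b n Y)
    {S T : TensorWord ι} (f : StructuralIso S T) (s : ℕ → G) (ε : Bool) (w : List (ι × Bool))
    (hs : ∀ i, i + 1 < S.length →
      φ (s i) = crossing (letter P X) b n Y (w.length + crossingIndex ε S.length i)) :
    Realizes (φ (f.braidWith s)) (strandIso P X b w (mapObj P X ε ((f.natIso P).app X))).hom := by
  induction f generalizing s ε w with
  | id S =>
    rw [StructuralIso.braidWith, map_one]
    cases ε
    · exact realizes_one_of_eq_actPre _ _ _ (actPre_refl _).symm
    · refine realizes_one_of_eq_actPre _ _ _ ?_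
      refine Eq.trans (actPre_refl _).symm (congrArg (fun f => actPre f _) ?_)
      ext
      exact (P.Φ.map_id _).symm
  | @comp S T U f g hf hg =>
    rw [StructuralIso.braidWith, map_mul]
    refine ((hf s ε w hs).mul (hg s ε w ?_)).of_eq ?_
    · rwa [← f.length_eq]
    · refine (congrArg Iso.hom (symm_trans_actPre_trans _ _ _ _ _)).symm.trans ?_
      cases ε
      · rfl
      · refine congrArg (fun h => Iso.hom (_ ≪≫ actPre h _)) ?_
        ext
        exact (P.Φ.map_comp _ _).symm
  | @inv S T f hf =>
    rw [StructuralIso.braidWith, map_inv]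
    rw [← f.length_eq] at hs
    cases ε
    · exact (hf s false w hs).inv.of_eq (congrArg Iso.hom (symm_trans_actPre_symm _ _ _))
    · exact (hf s true w hs).inv.of_eq (congrArg Iso.hom (symm_trans_actPre_symm _ _ _))
  | @tensor S₁ T₁ S₂ T₂ f g hf hg =>
    have e := hs
    simp only [TensorWord.length] at e
    rw [StructuralIso.braidWith, map_mul]
    cases ε
    · have h₁ := hf s false w fun i hi => e i (by lia)
      have h₂ := hg (fun i => s (S₁.length + i)) false (T₁.letters false w) fun i hi => by
        rw [e _ (by lia), length_letters, ← f.length_eq]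
        simp [crossingIndex, Nat.add_assoc]
      exact ((h₁.actConj_toStrands S₂ false).mul h₂).of_eq (congrArg Iso.hom
        (actGlue_symm_trans_actPre_tensor _ _ _ _ _ _ _)).symm
    · have h₁ := hf s true (S₂.letters true w) fun i hi => by
        rw [e _ (by lia), length_letters]
        congr 1
        simp only [crossingIndex, if_true]
        lia
      have h₂ := hg (fun i => s (S₁.length + i)) true w fun i hi => by
        rw [e _ (by lia)]
        congr 1
        simp only [crossingIndex, if_true]
        lia
      exact (h₁.mul (h₂.actConj_toStrands T₁ true)).of_eq (congrArg Iso.hom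
        (P.actGlue_symm_trans_actPre_tensor _ _ _ _ _ _ _)).symm
  | @phi S T f hf =>
    have e := hs
    simp only [TensorWord.length] at e
    rw [StructuralIso.braidWith]
    cases ε
    · exact hf _ true w fun i hi => by
        rw [e _ (by lia)]; congr 1
    · refine (hf _ false w fun i hi => ?_).of_eq (congrArg Iso.hom ?_)
      -- Two reflections of the positions cancel.
      · rw [e _ (by lia)]
        congr 1
        simp only [crossingIndex, if_true]
        simp
        lia
      -- Naturality of `t` replaces `Φ² f` by `f`.
      · refine Eq.trans ?_ (actPre_symm_trans_actPre _ _ _ _ _).symm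
        refine congrArg (fun h => _ ≪≫ actPre h _) ?_
        ext
        exact ((Iso.inv_comp_eq _).2 (P.t.hom.naturality _)).symm
  | α S T U =>
    rw [StructuralIso.braidWith, map_one]
    cases ε
    · exact realizes_one_of_eq_actPre _ _ _ (actGlue_assoc _ _ _)
    · exact realizes_one_of_eq_actPre _ _ _ (P.actGlue_assoc _ _ _)
  | lam S =>
    rw [StructuralIso.braidWith, map_one]
    cases ε
    · exact realizes_one_of_eq_actPre _ _ _ (actGlue_unit_left _)
    · exact realizes_one_of_eq_actPre _ _ _ (P.actGlue_unit_left _)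
  | rho S =>
    rw [StructuralIso.braidWith, map_one]
    cases ε
    · exact realizes_one_of_eq_actPre _ _ _ (actGlue_unit_right _)
    · exact realizes_one_of_eq_actPre _ _ _ (P.actGlue_unit_right _)
  | Φ₂ S T =>
    rw [StructuralIso.braidWith, map_one]
    cases ε
    · refine realizes_one_of_eq_actPre _ _ _ ?_
      exact ((actPre_actPre _ _ _).trans ((congrArg (fun f => actPre f _)
        (Iso.self_symm_id _)).trans (actPre_refl _))).symm
    · exact realizes_one_of_eq_actPre _ _ _ (P.actGlue_actPre_t _ _)
  | Φ₀ =>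
    rw [StructuralIso.braidWith, map_one]
    cases ε
    · exact realizes_one_of_eq_actPre _ _ _ rfl
    · exact realizes_one_of_eq_actPre _ _ _ P.actPre_t_unit
  | t S =>
    rw [StructuralIso.braidWith, map_one]
    cases ε
    · exact realizes_one_of_eq_actPre _ _ _ rfl
    · exact realizes_one_of_eq_actPre _ _ _ (P.actPre_t_obj _)
  | σ S T =>
    have e := hs
    simp only [TensorWord.length] at e
    rw [StructuralIso.braidWith]
    cases ε
    · exact realizes_blockBraid φ s S T false false w e
    -- Reflecting a block braid uses commutation of distant crossings, which is known only among `n`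
    -- strands.
    · rcases lt_or_ge n (w.length + T.length + S.length) with hn | hn
      · refine .of_length_lt ?_ ?_
        · rw [length_letters, TensorWord.length]; lia
        · rw [length_letters, length_letters, TensorWord.length, TensorWord.length]; lia
      · have e' : ∀ i, i + 1 < S.length + T.length →
            φ (s (S.length + T.length - 2 - i)) = crossing _ _ _ _ (w.length + i) := fun i hi => by
          rw [e _ (by lia)]
          congr 2
          simp only [crossingIndex, if_true]
          lia
        rw [map_blockBraid_reflect φ (s := fun i => s (S.length + T.length - 2 - i))
          (fun i hi => by congr 2; lia) fun i j hi hj => by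
            rw [e' i (by lia), e' j hj]
            exact commute_crossing_crossing (by lia) (by lia)]
        exact (realizes_blockBraid φ _ T S true true w
          fun i hi => e' i (by lia)).of_eq (congrArg Iso.hom
            (P.actGlue_symm_trans_actPre_braiding (hP _ _) _ _ _ _)).symm

end StructuralIsos

/-! ### The cylinder braiding -/

section Twist

variable {A : Type u₁} [Category.{v₁} A] [MonoidalCategory A] [BraidedCategory A]
variable {M : Type u₂} [Category.{v₂} M] [MonoidalRightAction A M]
variable (P : Z2BraidedPair A M) {m m' : M} {X Y Z : A}

namespace Z2BraidedPair

theorem κ_naturality_left (h : m ⟶ m') (X : A) :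
    h ⊵ᵣ X ≫ (P.κ m' X).hom = (P.κ m X).hom ≫ h ⊵ᵣ P.Φ.obj X := by
  have := P.κ_natural h (𝟙 X)
  rwa [MonoidalRightAction.actionHom_id, P.Φ.map_id, MonoidalRightAction.actionHom_id] at this

theorem κ_naturality_right (m : M) (f : X ⟶ Y) :
    m ⊴ᵣ f ≫ (P.κ m Y).hom = (P.κ m X).hom ≫ m ⊴ᵣ P.Φ.map f := by
  have := P.κ_natural (𝟙 m) f
  rwa [MonoidalRightAction.id_actionHom, MonoidalRightAction.id_actionHom] at this

theorem κ_act (m : M) (X Y : A) :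
    (P.κ (m ⊙ᵣ X) Y).hom =
      (crossIso m X Y).hom ≫ (P.κ m Y).hom ⊵ᵣ X ≫ (crossIso m (P.Φ.obj Y) X).hom := by
  rw [P.BP1, crossIso_hom, crossIso_hom]
  simp only [Category.assoc]

theorem κ_tensor (m : M) (X Y : A) :
    (P.κ m (X ⊗ Y)).hom =
      (αᵣ m X Y).hom ≫ (P.κ m X).hom ⊵ᵣ Y ≫ (crossIso m (P.Φ.obj X) Y).hom ≫
        (P.κ m Y).hom ⊵ᵣ P.Φ.obj X ≫ (αᵣ m (P.Φ.obj Y) (P.Φ.obj X)).inv ≫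
          m ⊴ᵣ (P.Φ₂ X Y).hom := by
  rw [P.BP2, crossIso_hom]
  simp only [Category.assoc]

/-- The cylinder braiding, up to identifications of the actions with given objects. -/
def actTwist {n n' : M} (s : m ⊙ᵣ X ≅ n) (s' : m ⊙ᵣ P.Φ.obj X ≅ n') : n ≅ n' :=
  s.symm ≪≫ P.κ m X ≪≫ s'

theorem actTwist_actPre {n n' : M} (f : X ≅ Y) (s : m ⊙ᵣ Y ≅ n) (s' : m ⊙ᵣ P.Φ.obj Y ≅ n') :
    P.actTwist (actPre f s) (actPre (P.Φ.mapIso f) s') = P.actTwist s s' := by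
  ext
  simp [actTwist, ← reassoc_of% P.κ_naturality_right]

/-- BP2 for normal forms: twist `X`, cross, twist `Y`. -/
theorem actTwist_actGlue {n₁ n₂ k₁ k₂ l₁ l₂ l₃ l₄ : M} (s : m ⊙ᵣ X ≅ n₁) (t : n₁ ⊙ᵣ Y ≅ n₂)
    (t' : m ⊙ᵣ P.Φ.obj Y ≅ k₁) (s' : k₁ ⊙ᵣ P.Φ.obj X ≅ k₂) (s₁ : m ⊙ᵣ P.Φ.obj X ≅ l₁)
    (t₁ : l₁ ⊙ᵣ Y ≅ l₂) (t₂ : m ⊙ᵣ Y ≅ l₃) (s₂ : l₃ ⊙ᵣ P.Φ.obj X ≅ l₄) :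
    P.actTwist (actGlue s t) (P.actGlue t' s') =
      actConj t (P.actTwist s s₁) t₁ ≪≫ actSwap s₁ t₁ t₂ s₂ ≪≫
        actConj s₂ (P.actTwist t₂ t') s' := by
  ext
  simp [actTwist, AntiInvolution.actGlue, actSwap_hom, κ_tensor]

/-- BP2 applied to `Φ Y ⊗ Φ X`, transported along `Φ₂` by naturality of `κ`; monoidality of `t`
removes the double `Φ` in the target. -/
theorem actTwist_actGlue_phi {n₁ n₂ k₁ k₂ l₁ l₂ l₃ l₄ : M} (t : m ⊙ᵣ P.Φ.obj Y ≅ n₁)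
    (s : n₁ ⊙ᵣ P.Φ.obj X ≅ n₂) (s' : m ⊙ᵣ X ≅ k₁) (t' : k₁ ⊙ᵣ Y ≅ k₂) (t₁ : m ⊙ᵣ Y ≅ l₁)
    (s₁ : l₁ ⊙ᵣ P.Φ.obj X ≅ l₂) (s₂ : m ⊙ᵣ P.Φ.obj X ≅ l₃) (t₂ : l₃ ⊙ᵣ Y ≅ l₄) :
    P.actTwist (P.actGlue t s) (actPre (P.t.app (X ⊗ Y)) (actGlue s' t')) =
      actConj s (P.actTwist t (actPre (P.t.app Y) t₁)) s₁ ≪≫ actSwap t₁ s₁ s₂ t₂ ≪≫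
        actConj t₂ (P.actTwist s₂ (actPre (P.t.app X) s')) t' := by
  have h := P.actTwist_actGlue t s (actPre (P.t.app X) s') (actPre (P.t.app Y) t')
    (actPre (P.t.app Y) t₁) s₁ s₂ (actPre (P.t.app Y) t₂)
  rw [AntiInvolution.actGlue_actPre_t] at h
  refine Eq.trans ?_ (h.trans ?_)
  · refine Eq.trans ?_ (P.actTwist_actPre (P.Φ₂ X Y).symm _ _)
    rw [actPre_actPre (P.Φ.mapIso (P.Φ₂ X Y).symm), Functor.mapIso_symm, Iso.symm_self_id,
      actPre_refl]
    rfl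
  · exact congrArg₂ (fun f g => _ ≪≫ f ≪≫ g) (actSwap_actPre_left (P.t.app Y) _ _ _ _)
      (actConj_actPre (P.t.app Y) _ _ _)

theorem κ_actionHomRight_naturality (h : m ⟶ m') (f : P.Φ.obj X ⟶ Y) :
    h ⊵ᵣ X ≫ (P.κ m' X).hom ≫ m' ⊴ᵣ f = ((P.κ m X).hom ≫ m ⊴ᵣ f) ≫ h ⊵ᵣ Y := by
  rw [reassoc_of% P.κ_naturality_left, Category.assoc, MonoidalRightAction.action_exchange]

theorem κ_act_actionHomRight (m : M) (f : P.Φ.obj X ⟶ Y) :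
    (P.κ (m ⊙ᵣ Z) X).hom ≫ (m ⊙ᵣ Z) ⊴ᵣ f =
      (crossIso m Z X).hom ≫ ((P.κ m X).hom ≫ m ⊴ᵣ f) ⊵ᵣ Z ≫ (crossIso m Y Z).hom := by
  rw [P.κ_act, MonoidalRightAction.comp_actionHomLeft, Category.assoc, Category.assoc,
    Category.assoc, crossIso_hom_naturality_left]

/-- No axiom treats the unit. BP2 at `𝟙 ⊗ 𝟙` shows that this isomorphism is idempotent, hence the
identity. -/
theorem actTwist_unit (m : M) :
    P.actTwist (ρᵣ m) (actPre P.Φ₀ (ρᵣ m)) = Iso.refl m := by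
  have h := P.actTwist_actGlue (ρᵣ m) (ρᵣ m) (actPre P.Φ₀ (ρᵣ m)) (actPre P.Φ₀ (ρᵣ m))
    (actPre P.Φ₀ (ρᵣ m)) (ρᵣ m) (ρᵣ m) (actPre P.Φ₀ (ρᵣ m))
  have hc : ∀ e : m ≅ m, actConj (ρᵣ[A] m) e (ρᵣ m) = e := fun e => by ext; simp
  rw [actSwap_actPre_left, actSwap_unit_left, actConj_actPre, hc, Iso.refl_trans,
    actGlue_unit_left, AntiInvolution.actGlue_unit_left, actTwist_actPre] at h
  ext
  exact (cancel_epi (P.actTwist (ρᵣ m) (actPre P.Φ₀ (ρᵣ m))).hom).1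
    ((congrArg Iso.hom h).symm.trans (Category.comp_id _).symm)

/-- BP1 for normal forms. -/
theorem actTwist_act {n₀ n₁ n₀' n₁' : M} (s₁ : (m ⊙ᵣ Z) ⊙ᵣ X ≅ n₁) (s₀ : m ⊙ᵣ X ≅ n₀)
    (s₀' : m ⊙ᵣ P.Φ.obj X ≅ n₀') (s₁' : (m ⊙ᵣ Z) ⊙ᵣ P.Φ.obj X ≅ n₁') :
    (P.actTwist s₁ s₁').hom =
      (actSwap (Iso.refl (m ⊙ᵣ Z)) s₁ s₀ (Iso.refl _)).hom ≫ (P.actTwist s₀ s₀').hom ⊵ᵣ Z ≫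
        (actSwap s₀' (Iso.refl _) (Iso.refl _) s₁').hom := by
  simp [actTwist, actSwap_hom, κ_act]

end Z2BraidedPair

open TensorWord Z2BraidedPair

variable {ι : Type w} (F : ι → A) (b : M)

/-- The cylinder braiding at a word with a sign. -/
def twistObj (P : Z2BraidedPair A M) (F : ι → A) (m : M) (S : TensorWord ι) : (ε : Bool) →
    (m ⊙ᵣ obj P.toAntiInvolution F ε S ≅ m ⊙ᵣ obj P.toAntiInvolution F ε (.phi S))
  | false => P.κ m _
  | true => P.κ m _

/-- The isomorphism between objects of strands that corresponds to the cylinder braiding. -/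
def twistIso (w : List (ι × Bool)) (S : TensorWord ι) (ε : Bool) :
    strands (letter P.toAntiInvolution F) b (S.letters ε w) ≅
      strands (letter P.toAntiInvolution F) b ((TensorWord.phi S).letters ε w) :=
  (S.toStrands _ F b ε w).symm ≪≫ twistObj P F _ S ε ≪≫ (TensorWord.phi S).toStrands _ F b ε w

/-- The cylinder twist of the first strand if there is no further strand, as a move. -/
def twistMove : StrandMove (letter P.toAntiInvolution F) b where
  list
    | [x] => [(x.1, !x.2)]
    | w => w
  length_list
    | [_] => rfl
    | _ :: _ :: _ => rfl
    | [] => rfl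
  list_list
    | [(_, false)] => rfl
    | [(_, true)] => rfl
    | _ :: _ :: _ => rfl
    | [] => rfl
  iso
    | [x] => twistIso P F b [] (.var x.1) x.2
    | _ :: _ :: _ => Iso.refl _
    | [] => Iso.refl _

/-- The cylinder twist of the strand in position `0`. -/
def twist (n : ℕ) (Y : M) : StrandGroup (letter P.toAntiInvolution F) b n Y :=
  ((twistMove P F b).lower (n - 1)).perm n Y

variable {P F b} {n : ℕ} {Y : M}

theorem realizes_twist (x : ι × Bool) :
    Realizes (twist P F b n Y) (twistIso P F b [] (.var x.1) x.2).hom :=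
  (twistMove P F b).realizes_perm [x]

theorem exists_realizes_twist (w : List (ι × Bool)) (hw : 1 ≤ w.length) :
    ∃ (w' : List (ι × Bool)) (h : strands (letter P.toAntiInvolution F) b w ⟶ strands _ b w'),
      Realizes (twist P F b n Y) h := by
  refine exists_realizes_of_le (p := 1) (fun w hw => ?_) w hw
  match w, hw with
  | [x], _ => exact ⟨_, _, realizes_twist x⟩

theorem commute_twist_crossing {p : ℕ} (h0 : 0 < p) (hp : p + 2 ≤ n) :
    Commute (twist P F b n Y) (crossing _ b n Y p) :=
  commute_crossing hp fun w hw => exists_realizes_twist w (by lia)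

theorem twistIso_tensor_false (w : List (ι × Bool)) (S T : TensorWord ι) :
    twistIso P F b w (.tensor S T) false =
      actConj (T.toStrands _ F b false _) (twistIso P F b w S false) (T.toStrands _ F b false _) ≪≫
        actSwap (S.toStrands P.toAntiInvolution F b true w) (T.toStrands _ F b false _)
          (T.toStrands _ F b false w) (S.toStrands _ F b true _) ≪≫
        actConj (S.toStrands _ F b true _) (twistIso P F b w T false)
          (S.toStrands _ F b true _) :=
  P.actTwist_actGlue _ _ _ _ _ _ _ _

theorem twistIso_tensor_true (w : List (ι × Bool)) (S T : TensorWord ι) :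
    twistIso P F b w (.tensor S T) true =
      actConj (S.toStrands _ F b true _) (twistIso P F b w T true) (S.toStrands _ F b true _) ≪≫
        actSwap (T.toStrands P.toAntiInvolution F b false w) (S.toStrands _ F b true _)
          (S.toStrands _ F b true w) (T.toStrands _ F b false _) ≪≫
        actConj (T.toStrands _ F b false _) (twistIso P F b w S true)
          (T.toStrands _ F b false _) :=
  P.actTwist_actGlue_phi _ _ _ _ _ _ _ _

/-- BP2 in both signs matches `poleBlockTwist_add`; a sign `true` exchanges the roles of the two
factors. -/
theorem realizes_poleBlockTwist {G : Type} [Group G]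
    (φ : G →* StrandGroup (letter P.toAntiInvolution F) b n Y) (s : ℕ → G) (k : G)
    (S : TensorWord ι) (ε : Bool)
    (hs : ∀ i, i + 1 < S.length → φ (s i) = crossing _ b n Y i)
    (hk : 0 < S.length → φ k = twist P F b n Y) :
    Realizes (φ (poleBlockTwist s k S.length)) (twistIso P F b [] S ε).hom := by
  induction S generalizing ε with
  | var i =>
    have h : φ (poleBlockTwist s k (TensorWord.var i).length) = twist P F b n Y := by
      rw [← hk Nat.zero_lt_one]
      simp [TensorWord.length, poleBlockTwist, strandBraid]
    rw [h]
    exact realizes_twist (i, ε)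
  | unit =>
    simp only [TensorWord.length, poleBlockTwist, map_one]
    cases ε
    · exact (Realizes.one _).of_eq (congrArg Iso.hom (P.actTwist_unit _)).symm
    · have e : twistIso P F b [] .unit true = Iso.refl _ :=
        (congrArg (P.actTwist _) P.actPre_t_unit).trans
          ((P.actTwist_actPre P.Φ₀ _ _).trans (P.actTwist_unit _))
      exact (Realizes.one _).of_eq (congrArg Iso.hom e).symm
  | tensor S T hS hT =>
    simp only [TensorWord.length] at hs hk
    have hS' := fun ε => hS ε (fun i hi => hs i (by lia)) (fun h => hk (by lia))
    have hT' := fun ε => hT ε (fun i hi => hs i (by lia)) (fun h => hk (by lia))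
    rcases lt_or_ge n (S.length + T.length) with hn | hn
    · refine .of_length_lt ?_ ?_
      · rw [length_letters, TensorWord.length]; simpa using hn
      · rw [length_letters, length_letters]; rfl
    · have hc : ∀ i j, i + 1 < j → j + 1 < S.length + T.length →
          Commute (φ (s i)) (φ (s j)) := fun i j hi hj => by
        rw [hs i (by lia), hs j hj]
        exact commute_crossing_crossing hi (by lia)
      have hc' : ∀ i, 0 < i → i + 1 < S.length + T.length → Commute (φ k) (φ (s i)) :=
        fun i hi hj => by
          rw [hs i hj, hk (by lia)]
          exact commute_twist_crossing hi (by lia)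
      cases ε
      · rw [TensorWord.length, poleBlockTwist_add φ hc hc', twistIso_tensor_false, mul_assoc]
        exact ((hS' false).actConj_toStrands T false).mul
          ((realizes_blockBraid φ s S T true false []
            fun i hi => by rw [hs i hi]; simp).mul
            ((hT' false).actConj_toStrands S true))
      · rw [TensorWord.length, Nat.add_comm, poleBlockTwist_add φ
          (fun i j hi hj => hc i j hi (by lia)) (fun i hi hj => hc' i hi (by lia)),
          twistIso_tensor_true, mul_assoc]
        exact ((hT' true).actConj_toStrands S true).mul
          ((realizes_blockBraid φ s T S false true []
            fun i hi => by rw [hs i (by lia)]; simp).mul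
            ((hS' true).actConj_toStrands T false))
  | phi S hS =>
    cases ε
    · exact hS true hs hk
    · refine (hS false hs hk).of_eq (congrArg Iso.hom ?_).symm
      refine Eq.trans ?_ (P.actTwist_actPre (P.t.app _) _ _)
      exact congrArg (P.actTwist _) (P.actPre_t_obj _)

/-- Induction on the strands between the block and the pole, with BP1 as the step from one to the
next. -/
theorem realizes_blockTwist {G : Type} [Group G]
    (φ : G →* StrandGroup (letter P.toAntiInvolution F) b n Y) (s : ℕ → G) (k : G)
    (w : List (ι × Bool)) (S : TensorWord ι) (ε : Bool)
    (hs : ∀ i, i + 1 < w.length + S.length → φ (s i) = crossing _ b n Y i)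
    (hk : 0 < w.length + S.length → φ k = twist P F b n Y) :
    Realizes (φ (blockTwist s k w.length S.length)) (twistIso P F b w S ε).hom := by
  induction w with
  | nil =>
    rw [List.length_nil, blockTwist_zero]
    exact realizes_poleBlockTwist φ s k S ε (fun i hi => hs i (by simpa using hi))
      (fun h => hk (by simpa using h))
  | cons x w ih =>
    rw [List.length_cons] at hs hk ⊢
    rcases lt_or_ge n (w.length + 1 + S.length) with hn | hn
    · refine .of_length_lt ?_ ?_
      · rw [length_letters, List.length_cons]; exact hn
      · rw [length_letters, length_letters]; rfl
    · rw [blockTwist_succ φ k fun i j hi hj => by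
        rw [hs i (by lia), hs j hj]
        exact commute_crossing_crossing hi (by lia), mul_assoc]
      have h₁ := realizes_blockBraid φ (fun i => s (w.length + i)) (.var x.1) S x.2 ε w
        fun i hi => hs _ (by simp only [TensorWord.length] at hi; lia)
      have h₂ := realizes_blockBraid φ (fun i => s (w.length + i)) (.phi S) (.var x.1) ε x.2 w
        fun i hi => hs _ (by simp only [TensorWord.length] at hi; lia)
      refine (h₁.mul (((ih (fun i hi => hs i (by lia)) fun h => hk (by lia)).whiskerRight x).mul
        h₂)).of_eq ?_
      cases ε <;> exact (P.actTwist_act _ _ _ _).symm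

/-- The cylinder twist of a letter. -/
def letterTwist (P : Z2BraidedPair A M) (F : ι → A) (m : M) : (x : ι × Bool) →
    (m ⊙ᵣ letter P.toAntiInvolution F x ⟶ m ⊙ᵣ letter P.toAntiInvolution F (x.1, !x.2))
  | (_, false) => (P.κ m _).hom
  | (_, true) => (P.κ m _).hom ≫ m ⊴ᵣ (P.t.app _).hom

theorem twistIso_var_hom (w : List (ι × Bool)) (x : ι × Bool) :
    (twistIso P F b w (.var x.1) x.2).hom = letterTwist P F (strands _ b w) x := by
  rcases x with ⟨i, _ | _⟩
  · exact (Category.id_comp _).trans (Category.comp_id _)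
  · exact (Category.id_comp _).trans (congrArg _ (Category.comp_id _))

theorem letterTwist_naturality (h : m ⟶ m') (x : ι × Bool) :
    h ⊵ᵣ letter P.toAntiInvolution F x ≫ letterTwist P F m' x =
      letterTwist P F m x ≫ h ⊵ᵣ letter P.toAntiInvolution F (x.1, !x.2) := by
  rcases x with ⟨i, _ | _⟩
  · exact P.κ_naturality_left h _
  · exact P.κ_actionHomRight_naturality h _

theorem letterTwist_act (m : M) (Z : A) (x : ι × Bool) :
    letterTwist P F (m ⊙ᵣ Z) x =
      (crossIso m Z (letter P.toAntiInvolution F x)).hom ≫ letterTwist P F m x ⊵ᵣ Z ≫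
        (crossIso m (letter P.toAntiInvolution F (x.1, !x.2)) Z).hom := by
  rcases x with ⟨i, _ | _⟩
  · exact P.κ_act _ _ _
  · exact P.κ_act_actionHomRight m _

/-- The reflection equation. -/
theorem crossing_twist_reflection (hn : 2 ≤ n) :
    crossing _ b n Y 0 * twist P F b n Y * crossing _ b n Y 0 * twist P F b n Y =
      twist P F b n Y * crossing _ b n Y 0 * twist P F b n Y * crossing _ b n Y 0 := by
  refine StrandGroup.ext_of_realizes 2 hn fun w hw => ?_
  match w, hw with
  | [x, y], _ =>
    have h₁ : ∀ y : ι × Bool, Realizes (w := [y]) (w' := [(y.1, !y.2)]) (twist P F b n Y)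
        (letterTwist P F b y) := fun y => (realizes_twist y).of_eq (twistIso_var_hom _ _)
    -- By BP1, crossing, twist and crossing together are the twist of `x` with `y` absorbed into the
    -- module object; naturality in that object, along the twist of `y`, is the reflection equation.
    have h₂ : ∀ y : ι × Bool, Realizes (w := [x, y]) (w' := [(x.1, !x.2), y])
        (crossing _ b n Y 0 * (twist P F b n Y * crossing _ b n Y 0))
        (letterTwist P F (b ⊙ᵣ letter P.toAntiInvolution F y) x) := fun y =>
      ((realizes_crossing [] x y).mul (((h₁ x).whiskerRight y).mul
        (realizes_crossing [] y (x.1, !x.2)))).of_eq (letterTwist_act _ _ _).symm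
    have e : ∀ c t : StrandGroup (letter P.toAntiInvolution F) b n Y,
        c * t * c * t = c * (t * c) * t ∧ t * c * t * c = t * (c * (t * c)) := fun c t => by
      simp only [mul_assoc, and_self]
    rw [(e _ _).1, (e _ _).2]
    exact ⟨_, _, (h₂ y).mul ((h₁ y).whiskerRight (x.1, !x.2)),
      (((h₁ y).whiskerRight x).mul (h₂ (y.1, !y.2))).of_eq
        (letterTwist_naturality (letterTwist P F b y) x)⟩

end Twist

/-! ### Module words -/

section ModuleWords

open TensorWord

variable {A : Type u₁} [Category.{v₁} A] [MonoidalCategory A]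
variable {M : Type u₂} [Category.{v₂} M] [MonoidalRightAction A M]
variable {ι : Type w}

/-- The strands of a module word. -/
def ModuleWord.letters : ModuleWord ι → List (ι × Bool)
  | .base => []
  | .act m S => S.letters false m.letters

theorem ModuleWord.length_letters (m : ModuleWord ι) : m.letters.length = m.length := by
  induction m with
  | base => rfl
  | act m S ih => rw [letters, TensorWord.length_letters, ih, length]

section

variable {m m' n n' l l' k : M} {X Y : A}

/-- Act on an identified object. -/
@[simps]
def actPost (e : m ≅ m') (s : m' ⊙ᵣ X ≅ n) : m ⊙ᵣ X ≅ n where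
  hom := e.hom ⊵ᵣ X ≫ s.hom
  inv := s.inv ≫ e.inv ⊵ᵣ X

theorem actPost_symm_trans_actIso (e : m ≅ n) (s : n ⊙ᵣ X ≅ l) (f : m ≅ m') (g : X ≅ Y)
    (e' : m' ≅ n') (s' : n' ⊙ᵣ Y ≅ l') (s'' : n' ⊙ᵣ X ≅ k) :
    (actPost e s).symm ≪≫ actIso f g ≪≫ actPost e' s' =
      actConj s (e.symm ≪≫ f ≪≫ e') s'' ≪≫ s''.symm ≪≫ actPre g s' := by
  ext
  simp [MonoidalRightAction.actionHom_def, MonoidalRightAction.action_exchange_assoc]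

theorem actPost_assoc (e : m ≅ n) (s : n ⊙ᵣ X ≅ l) (t : l ⊙ᵣ Y ≅ k) :
    (actPost (actPost e s) t).symm ≪≫ (αᵣ m X Y).symm ≪≫ actPost e (actGlue s t) =
      Iso.refl k := by
  ext
  simp
  simp only [← MonoidalRightAction.comp_actionHomLeft_assoc,
    Iso.inv_hom_id, Category.id_comp,
    MonoidalRightAction.id_actionHomLeft]

theorem actPost_unit (e : m ≅ n) :
    (actPost e (ρᵣ[A] n)).symm ≪≫ ρᵣ m ≪≫ e = Iso.refl n := by
  ext
  simp

end

/-- The value of a module word is the successive action of its strands. -/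
def ModuleWord.toStrands (P : AntiInvolution A) (b : M) (X : ι → A) : (m : ModuleWord ι) →
    ((m.functor P).obj (b, X) ≅ strands (letter P X) b m.letters)
  | .base => Iso.refl _
  | .act m S => actPost (m.toStrands P b X) (S.toStrands P X b false _)

theorem ModuleStructuralIso.length_eq {m n : ModuleWord ι} (f : ModuleStructuralIso m n) :
    m.length = n.length := by
  induction f with
  | id => rfl
  | comp _ _ hf hg => exact hf.trans hg
  | inv _ hf => exact hf.symm
  | act _ g hf => exact congrArg₂ (· + ·) hf g.length_eq
  | a => exact Nat.add_assoc _ _ _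
  | r => rfl
  | κ => rfl

variable [BraidedCategory A] {P : Z2BraidedPair A M} {F : ι → A} {b : M} {n : ℕ} {Y : M}

theorem Z2BraidedPair.actPost_symm_trans_κ {m m' l l' : M} {X : A} (e : m ≅ m')
    (s : m' ⊙ᵣ X ≅ l) (s' : m' ⊙ᵣ P.Φ.obj X ≅ l') :
    (actPost e s).symm ≪≫ P.κ m X ≪≫ actPost e s' = P.actTwist s s' := by
  ext
  simp [actTwist, ← reassoc_of% P.κ_naturality_left]

/-- A module word begins at the pole, so neither a sign nor preceding strands are needed here. -/
theorem ModuleStructuralIso.realizes {G : Type} [Group G]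
    (φ : G →* StrandGroup (letter P.toAntiInvolution F) b n Y)
    {m m' : ModuleWord ι} (f : ModuleStructuralIso m m') (s : ℕ → G) (k : G)
    (hs : ∀ i, i + 1 < m.length → φ (s i) = crossing _ b n Y i)
    (hk : 0 < m.length → φ k = twist P F b n Y) :
    Realizes (φ (f.braidWith s k)) ((m.toStrands P.toAntiInvolution b F).symm ≪≫
      (f.natIso P).app (b, F) ≪≫ m'.toStrands P.toAntiInvolution b F).hom := by
  induction f with
  | id m =>
    rw [ModuleStructuralIso.braidWith, map_one]
    refine (Realizes.one _).of_eq ?_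
    simp [ModuleStructuralIso.natIso]
  | @comp m₁ m₂ m₃ f g hf hg =>
    rw [ModuleStructuralIso.braidWith, map_mul]
    rw [f.length_eq] at hs hk
    refine ((hf (f.length_eq ▸ hs) (f.length_eq ▸ hk)).mul (hg hs hk)).of_eq ?_
    simp [ModuleStructuralIso.natIso]
  | @inv m₁ m₂ f hf =>
    rw [ModuleStructuralIso.braidWith, map_inv]
    rw [← f.length_eq] at hs hk
    refine (hf hs hk).inv.of_eq ?_
    simp [ModuleStructuralIso.natIso]
  | @act m₁ m₂ S T f g hf =>
    simp only [ModuleWord.length] at hs hk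
    rw [ModuleStructuralIso.braidWith, map_mul]
    have h₁ := hf (fun i hi => hs i (by lia)) fun h => hk (by lia)
    have h₂ := g.realizes P.Φ_braided φ (fun i => s (m₁.length + i)) false m₂.letters
      fun i hi => by
        rw [hs _ (by lia), ModuleWord.length_letters, f.length_eq]
        rfl
    exact ((h₁.actConj_toStrands S false).mul h₂).of_eq
      (congrArg Iso.hom (actPost_symm_trans_actIso _ _ _ _ _ _ _)).symm
  | a m S T =>
    rw [ModuleStructuralIso.braidWith, map_one]
    exact (Realizes.one _).of_eq (congrArg Iso.hom (actPost_assoc _ _ _)).symm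
  | r m =>
    rw [ModuleStructuralIso.braidWith, map_one]
    exact (Realizes.one _).of_eq (congrArg Iso.hom (actPost_unit _)).symm
  | κ m S =>
    simp only [ModuleWord.length] at hs hk
    rw [ModuleStructuralIso.braidWith]
    have h := realizes_blockTwist (P := P) φ s k m.letters S false
      (by rwa [ModuleWord.length_letters]) (by rwa [ModuleWord.length_letters])
    rw [ModuleWord.length_letters] at h
    exact h.of_eq (congrArg Iso.hom (P.actPost_symm_trans_κ _ _ _)).symm

end ModuleWords

/-! ### Representations of the braid groups -/

section Representations

variable {A : Type u₁} [Category.{v₁} A] [MonoidalCategory A] [BraidedCategory A]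
variable {M : Type u₂} [Category.{v₂} M] [MonoidalRightAction A M]

/-- The braid group acts on strands by crossings. -/
def BraidGroup.toStrandGroup {Λ : Type w} (L : Λ → A) (b : M) (n : ℕ) (Y : M) :
    BraidGroup n →* StrandGroup L b n Y :=
  PresentedGroup.toGroup (rels := {r | BraidRel n r})
    (f := fun i : Fin (n - 1) => crossing L b n Y i) (by
    rintro _ (⟨i, j, h⟩ | ⟨i, j, h⟩)
    · simp only [map_mul, map_inv, FreeGroup.lift_apply_of, mul_inv_eq_one, ← h]
      exact crossing_braid (by lia)
    · simp only [map_mul, map_inv, FreeGroup.lift_apply_of, mul_inv_eq_one]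
      exact commute_crossing_crossing h (by lia))

theorem BraidGroup.toStrandGroup_σ {Λ : Type w} (L : Λ → A) (b : M) {n : ℕ} (Y : M) {i : ℕ}
    (hi : i + 1 < n) :
    BraidGroup.toStrandGroup L b n Y (BraidGroup.σ n i) = crossing L b n Y i := by
  rw [BraidGroup.σ, dif_pos (show i < n - 1 by lia), toStrandGroup, PresentedGroup.toGroup.of]

variable {ι : Type w} (P : Z2BraidedPair A M) (F : ι → A) (b : M)

/-- The cylinder braid group acts on strands by crossings and cylinder twists. -/
def CylinderBraidGroup.toStrandGroup (n : ℕ) (Y : M) :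
    CylinderBraidGroup n →* StrandGroup (TensorWord.letter P.toAntiInvolution F) b n Y :=
  PresentedGroup.toGroup (rels := {r | CylinderRel n r})
    (f := fun
      | .σ i => crossing _ b n Y i
      | .κ _ => twist P F b n Y) (by
    rintro _ (⟨i, j, h⟩ | ⟨i, j, h⟩ | ⟨hn, i, h⟩ | ⟨hn, i, h⟩)
    · simp only [map_mul, map_inv, FreeGroup.lift_apply_of, mul_inv_eq_one, ← h]
      exact crossing_braid (by lia)
    · simp only [map_mul, map_inv, FreeGroup.lift_apply_of, mul_inv_eq_one]
      exact commute_crossing_crossing h (by lia)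
    · simp only [map_mul, map_inv, FreeGroup.lift_apply_of, mul_inv_eq_one, h]
      exact crossing_twist_reflection (by lia)
    · simp only [map_mul, map_inv, FreeGroup.lift_apply_of, mul_inv_eq_one]
      exact (commute_twist_crossing h (by lia)).symm)

theorem CylinderBraidGroup.toStrandGroup_σ {n : ℕ} (Y : M) {i : ℕ} (hi : i + 1 < n) :
    CylinderBraidGroup.toStrandGroup P F b n Y (CylinderBraidGroup.σ n i) =
      crossing _ b n Y i := by
  rw [CylinderBraidGroup.σ, dif_pos (show i < n - 1 by lia), toStrandGroup,
    PresentedGroup.toGroup.of]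

theorem CylinderBraidGroup.toStrandGroup_κ {n : ℕ} (Y : M) (hn : 0 < n) :
    CylinderBraidGroup.toStrandGroup P F b n Y (CylinderBraidGroup.κ n) = twist P F b n Y := by
  rw [CylinderBraidGroup.κ, dif_pos hn, toStrandGroup, PresentedGroup.toGroup.of]

end Representations

/-! ### Coherence -/

theorem StructuralIso.natIso_eq_of_braid_eq {A : Type u₁} [Category.{v₁} A] [MonoidalCategory A]
    [BraidedCategory A] (P : AntiInvolution A)
    (hP : ∀ X Y : A, (P.Φ₂ X Y).hom ≫ P.Φ.map (β_ X Y).hom =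
      (β_ (P.Φ.obj Y) (P.Φ.obj X)).hom ≫ (P.Φ₂ Y X).hom)
    {ι : Type w} {S T : TensorWord ι} (f g : StructuralIso S T) (h : f.braid = g.braid) :
    f.natIso P = g.natIso P := by
  ext X
  have hS : (S.letters false []).length = S.length := by
    rw [TensorWord.length_letters]; exact Nat.zero_add _
  have H : ∀ f : StructuralIso S T, _ := fun f =>
    -- `A` acts on itself from the right, and the unit serves as the pole.
    f.realizes hP (BraidGroup.toStrandGroup (TensorWord.letter P X) (𝟙_ A) S.length
      (strands (TensorWord.letter P X) (𝟙_ A) (S.letters false []))) (BraidGroup.σ S.length)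
      false [] fun i hi => (BraidGroup.toStrandGroup_σ _ _ _ hi).trans (by
        rw [List.length_nil, Nat.zero_add]; rfl)
  have e := (H f).hom_ext hS (by
    have hg := H g
    change Realizes (BraidGroup.toStrandGroup _ _ _ _ g.braid) _ at hg
    rw [← h] at hg
    exact hg)
  -- Cancelling the normal forms leaves an equality whiskered by the unit, and this whiskering is
  -- faithful.
  have e' := (cancel_mono _).1 ((cancel_epi _).1 e)
  exact (MonoidalCategory.whiskerLeft_iff _ _).1 e'

theorem ModuleStructuralIso.natIso_eq_of_cylinderBraid_eq {A : Type u₁} [Category.{v₁} A]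
    [MonoidalCategory A] [BraidedCategory A] {M : Type u₂} [Category.{v₂} M]
    [MonoidalRightAction A M] (P : Z2BraidedPair A M) {ι : Type w} {m m' : ModuleWord ι}
    (f g : ModuleStructuralIso m m') (h : f.cylinderBraid = g.cylinderBraid) :
    f.natIso P = g.natIso P := by
  ext ⟨b, X⟩
  have H : ∀ f : ModuleStructuralIso m m', _ := fun f =>
    f.realizes (CylinderBraidGroup.toStrandGroup P X b m.length
      (strands (TensorWord.letter P.toAntiInvolution X) b m.letters))
      (CylinderBraidGroup.σ m.length) (CylinderBraidGroup.κ m.length)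
      (fun i hi => CylinderBraidGroup.toStrandGroup_σ _ _ _ _ hi)
      fun hm => CylinderBraidGroup.toStrandGroup_κ _ _ _ _ hm
  have e := (H f).hom_ext m.length_letters (by
    have hg := H g
    change Realizes (CylinderBraidGroup.toStrandGroup _ _ _ _ _ g.cylinderBraid) _ at hg
    rw [← h] at hg
    exact hg)
  exact (cancel_mono _).1 ((cancel_epi _).1 e)

theorem mainTheorem2 {A : Type u₁} [Category.{v₁} A] [MonoidalCategory A] [BraidedCategory A]
    {M : Type u₂} [Category.{v₂} M] [MonoidalRightAction A M] (P : Z2BraidedPair A M)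
    {ι : Type w} :
    (∀ {T₁ T₂ : TensorWord ι} (f g : StructuralIso T₁ T₂),
      f.braid = g.braid → f.natIso P.toAntiInvolution = g.natIso P.toAntiInvolution) ∧
    (∀ {T₁ T₂ : ModuleWord ι} (f g : ModuleStructuralIso T₁ T₂),
      f.cylinderBraid = g.cylinderBraid → f.natIso P = g.natIso P) :=
  ⟨fun f g h => f.natIso_eq_of_braid_eq P.toAntiInvolution P.Φ_braided g h,
    fun f g h => f.natIso_eq_of_cylinderBraid_eq P g h⟩
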